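/- Let $d\ge 1$, let $R\subset\mathbb R^d$ be a measurable set containing $\mathbf 0$ as an interior point, and let $f,g:R\to\mathbb R$ be measurable. Write $\rho=|\mathbf x|$, $\Omega=\mathbf x/\rho\in S^{d-1}$, and let $d\Omega$ be the surface measure on $S^{d-1}$ (so $d^d\mathbf x=\rho^{d-1}\,d\rho\,d\Omega$; for $d=1$ it is counting measure on $\{\pm1\}$). Suppose that $f$ attains its unique minimum value $0$ at $\mathbf 0$ and is otherwise bounded away from zero, i.e. for every $\delta>0$ there is $A>0$ with $f(\mathbf x)\ge A$ for all $\mathbf x\in R$ with $|\mathbf x|\ge\delta$. Suppose that there are an integer $N\ge1$, real numbers $\nu>0$ and $\lambda>0$, continuous functions $f_0,\dots,f_N:S^{d-1}\to\mathbb R$ with $f_0>0$, and functions $g_0,\dots,g_N:S^{d-1}\to\mathbb R$ such that, uniformly in $\Omega\in S^{d-1}$ as $\rho\to0^+$, $$f(\rho,\Omega)=\rho^{\nu}\sum_{j=0}^{N}f_j(\Omega)\rho^j+o(\rho^{N+\nu}),\qquad g(\rho,\Omega)=\rho^{\lambda-d}\sum_{j=0}^{N}g_j(\Omega)\rho^j+o(\rho^{N+\lambda-d}).$$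 If $\int_R e^{-k_0f}g\,d^d\mathbf x$ converges absolutely for some $k_0>0$, then $\int_R e^{-kf}g\,d^d\mathbf x$ converges absolutely for all $k\ge k_0$, and $$\int_R e^{-kf}g\,d^d\mathbf x=\sum_{j=0}^{N}\zeta_j\,k^{-(j+\lambda)/\nu}+o\bigl(k^{-(N+\lambda)/\nu}\bigr),\qquad k\to\infty,$$ where the coefficients are given by the absolutely convergent integrals $$\zeta_j=\frac1\nu\,\Gamma\Bigl(\frac{j+\lambda}{\nu}\Bigr)\int_{S^{d-1}}\Bigl[f_0(\Omega)^{-(j+\lambda)/\nu}\sum_{m=0}^{j}g_{j-m}(\Omega)\sum_{r=1}^{m}\binom{-\frac{j+\lambda}{\nu}}{r}\frac{f_m^{(r)}(\Omega)}{f_0(\Omega)^r}\Bigr]d\Omega .$$ Here $$f_m^{(r)}(\Omega)=\sum_{\substack{n_1+\cdots+n_r=m\\ n_i\ge1}}f_{n_1}(\Omega)\cdots f_{n_r}(\Omega)$$ (the sum over ordered $r$-tuples of positive integers) is the partial ordinary Bell polynomial, $\binom{\alpha}{r}=\alpha(\alpha-1)\cdots(\alpha-r+1)/r!$, and the empty sum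 over $r$ (the case $m=0$) is understood to be $1$. -/

import Mathlib

open MeasureTheory Filter Asymptotics
open scoped Topology

noncomputable section

namespace LaplaceExpansion

/-- The unit sphere `S^{d-1}` of `ℝ^d`, as a type. -/
abbrev USphere (d : ℕ) : Type :=
  Metric.sphere (0 : EuclideanSpace ℝ (Fin d)) 1

/-- The surface measure `dΩ` on `S^{d-1}` induced by Lebesgue measure, normalised by
`d^d x = ρ^{d-1} dρ dΩ`. For `d = 1` it is the counting measure on `{1, -1}`. -/
def surfaceMeasure (d : ℕ) : Measure (USphere d) :=
  (volume : Measure (EuclideanSpace ℝ (Fin d))).toSphere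

/-- The radial expansion `F(ρ, Ω) = ρ^p ∑_{j=0}^N c_j(Ω) ρ^j + o(ρ^{N+p})` as `ρ → 0⁺`,
uniformly in `Ω ∈ S^{d-1}`. Only `c_0, …, c_N` are used. -/
def HasRadialExpansion {d : ℕ} (F : EuclideanSpace ℝ (Fin d) → ℝ) (p : ℝ) (N : ℕ)
    (c : ℕ → USphere d → ℝ) : Prop :=
  ∀ ε : ℝ, 0 < ε → ∃ δ : ℝ, 0 < δ ∧ ∀ ρ : ℝ, 0 < ρ → ρ < δ → ∀ Ω : USphere d,
    |F (ρ • (Ω : EuclideanSpace ℝ (Fin d))) -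
        ρ ^ p * ∑ j ∈ Finset.range (N + 1), c j Ω * ρ ^ j| ≤ ε * ρ ^ ((N : ℝ) + p)

/-- The generalised binomial coefficient `α (α - 1) ⋯ (α - r + 1) / r!` for real `α`. -/
def genBinom (α : ℝ) (r : ℕ) : ℝ :=
  (∏ i ∈ Finset.range r, (α - (i : ℝ))) / (r.factorial : ℝ)

/-- The partial ordinary Bell polynomial `a_m^{(r)}`: the sum of `a_{n_1} ⋯ a_{n_r}` over all
ordered tuples of positive integers with `n_1 + ⋯ + n_r = m`. -/
def bell (a : ℕ → ℝ) (m r : ℕ) : ℝ :=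
  ∑ n ∈ (Finset.Nat.antidiagonalTuple r m).filter (fun n => ∀ i, 1 ≤ n i), ∏ i, a (n i)

/-- The inner sum `∑_{r=1}^m binom(-s, r) a_m^{(r)} / a_0^r`, where the empty sum (`m = 0`)
is understood to be `1`. -/
def innerSum (s : ℝ) (a : ℕ → ℝ) (m : ℕ) : ℝ :=
  if m = 0 then 1
  else ∑ r ∈ Finset.Icc 1 m, genBinom (-s) r * (bell a m r / a 0 ^ r)

/-- The integrand of the `j`-th coefficient, at a fixed direction `Ω` where `f_i(Ω) = a i` and
`g_i(Ω) = b i`. -/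
def coeffIntegrand (ν lam : ℝ) (a b : ℕ → ℝ) (j : ℕ) : ℝ :=
  a 0 ^ (-(((j : ℝ) + lam) / ν)) *
    ∑ m ∈ Finset.range (j + 1), b (j - m) * innerSum (((j : ℝ) + lam) / ν) a m

/-- The coefficient `ζ_j`. -/
def zeta {d : ℕ} (ν lam : ℝ) (fc gc : ℕ → USphere d → ℝ) (j : ℕ) : ℝ :=
  (1 / ν) * Real.Gamma (((j : ℝ) + lam) / ν) *
    ∫ Ω : USphere d, coeffIntegrand ν lam (fun i => fc i Ω) (fun i => gc i Ω) j
      ∂(surfaceMeasure d)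

end LaplaceExpansion

end

/-! Near the origin write `f = ρ^ν (f_0 + D)` and `g = ρ^(λ-d) G`, where `D = O(ρ)` and `D`, `G`
have expansions in `ρ` up to `o(ρ^N)`, uniformly in the direction. With `u = k ρ^ν` the integrand
becomes `ρ^(λ-d) e^(-u f_0) e^(-u D) G`. The idea is to treat `u` as a parameter independent of `ρ`
and to expand `e^(-u D) G` in powers of `ρ` alone, through order `N`; the coefficients are
polynomials in `u`.

The remainder is at most a small multiple of `ρ^N (1+u)^(N+1) e^(c u)`. If `3c ≤ f_0`, the factor
`e^(-u f_0)` absorbs this growth and still leaves `e^(-c u)`. This is `exists_integrand_estimate`.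
In polar coordinates such a remainder integrates to a small multiple of `k^(-(N+λ)/ν)`.

Each model term is integrated over all of `(0, ∞)`, where it is a Gamma integral. Powers of `u` only
shift the Gamma argument, and `Γ(s+r)/Γ(s)` supplies the generalised binomials
(`integral_rpow_mul_expCoeff`). Extending the model terms beyond a ball costs one extra factor
`k^(-1/ν)`, while the true integrand off the ball is exponentially small because `f` is bounded
below there.

The `g_j` are not assumed measurable or integrable. Both properties come from `g` itself: it is
integrable near the origin, so by Fubini it is integrable on spheres of arbitrarily small radius,
and the `g_j` can be recovered from its values on these spheres (`integrable_expansion_coeff`). -/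

namespace LaplaceExpansion

/-! ### Truncated power series in the radius -/

/-- The value at `ρ` of the truncation of a power series to degree at most `N`. -/
noncomputable def truncEval (N : ℕ) (ρ : ℝ) (φ : PowerSeries ℝ) : ℝ :=
  ∑ j ∈ Finset.range (N + 1), PowerSeries.coeff j φ * ρ ^ j

/-- The sum of the absolute values of the coefficients of degree at most `N`. -/
noncomputable def truncNorm (N : ℕ) (φ : PowerSeries ℝ) : ℝ :=
  ∑ j ∈ Finset.range (N + 1), |PowerSeries.coeff j φ|

/-- The truncation to `r ≤ N` of the series `exp (-u P) = ∑ (-u)^r / r! P^r`. -/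
noncomputable def expSeries (N : ℕ) (u : ℝ) (P : PowerSeries ℝ) : PowerSeries ℝ :=
  ∑ r ∈ Finset.range (N + 1), ((-u) ^ r / (r.factorial : ℝ)) • P ^ r

lemma truncNorm_nonneg (N : ℕ) (φ : PowerSeries ℝ) : 0 ≤ truncNorm N φ :=
  Finset.sum_nonneg fun _ _ => abs_nonneg _

lemma sum_range_sum_antidiagonal (N : ℕ) (h : ℕ × ℕ → ℝ) :
    ∑ k ∈ Finset.range (N + 1), ∑ p ∈ Finset.HasAntidiagonal.antidiagonal k, h p =
      ∑ p ∈ (Finset.range (N + 1) ×ˢ Finset.range (N + 1)).filter (fun p => p.1 + p.2 ≤ N),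
        h p := by
  rw [← Finset.sum_fiberwise_of_maps_to (g := fun p : ℕ × ℕ => p.1 + p.2)
    (t := Finset.range (N + 1))]
  · refine Finset.sum_congr rfl fun k hk => Finset.sum_congr ?_ fun _ _ => rfl
    ext p
    simp only [Finset.HasAntidiagonal.mem_antidiagonal, Finset.mem_filter, Finset.mem_product,
      Finset.mem_range] at *
    omega
  · intro p hp
    simp only [Finset.mem_filter, Finset.mem_range] at *
    omega

lemma truncNorm_mul_le (N : ℕ) (φ ψ : PowerSeries ℝ) :
    truncNorm N (φ * ψ) ≤ truncNorm N φ * truncNorm N ψ := by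
  calc truncNorm N (φ * ψ)
      ≤ ∑ k ∈ Finset.range (N + 1), ∑ p ∈ Finset.HasAntidiagonal.antidiagonal k,
          |PowerSeries.coeff p.1 φ| * |PowerSeries.coeff p.2 ψ| := by
        refine Finset.sum_le_sum fun k _ => ?_
        rw [PowerSeries.coeff_mul]
        refine (Finset.abs_sum_le_sum_abs _ _).trans (le_of_eq ?_)
        simp only [abs_mul]
    _ ≤ ∑ p ∈ Finset.range (N + 1) ×ˢ Finset.range (N + 1),
          |PowerSeries.coeff p.1 φ| * |PowerSeries.coeff p.2 ψ| := by
        rw [sum_range_sum_antidiagonal N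
          (fun p => |PowerSeries.coeff p.1 φ| * |PowerSeries.coeff p.2 ψ|)]
        exact Finset.sum_le_sum_of_subset_of_nonneg (Finset.filter_subset _ _)
          fun _ _ _ => by positivity
    _ = truncNorm N φ * truncNorm N ψ := by
        rw [truncNorm, truncNorm, Finset.sum_mul_sum, Finset.sum_product]

/-- The products lost by truncating have total degree at least `N + 1`, hence carry a factor at most
`ρ^(N+1)` when `ρ ≤ 1`. -/
lemma abs_truncEval_mul_sub_le (N : ℕ) {ρ : ℝ} (h0 : 0 ≤ ρ) (h1 : ρ ≤ 1)
    (φ ψ : PowerSeries ℝ) :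
    |truncEval N ρ φ * truncEval N ρ ψ - truncEval N ρ (φ * ψ)| ≤
      ρ ^ (N + 1) * (truncNorm N φ * truncNorm N ψ) := by
  set h : ℕ × ℕ → ℝ := fun p =>
    PowerSeries.coeff p.1 φ * PowerSeries.coeff p.2 ψ * ρ ^ (p.1 + p.2) with hh
  have e1 : truncEval N ρ φ * truncEval N ρ ψ =
      ∑ p ∈ Finset.range (N + 1) ×ˢ Finset.range (N + 1), h p := by
    rw [truncEval, truncEval, Finset.sum_mul_sum, Finset.sum_product]
    refine Finset.sum_congr rfl fun i _ => Finset.sum_congr rfl fun j _ => ?_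
    simp only [hh, pow_add]; ring
  have e2 : truncEval N ρ (φ * ψ) =
      ∑ p ∈ (Finset.range (N + 1) ×ˢ Finset.range (N + 1)).filter (fun p => p.1 + p.2 ≤ N),
        h p := by
    rw [← sum_range_sum_antidiagonal, truncEval]
    refine Finset.sum_congr rfl fun k _ => ?_
    rw [PowerSeries.coeff_mul, Finset.sum_mul]
    refine Finset.sum_congr rfl fun p hp => ?_
    rw [hh, ← Finset.HasAntidiagonal.mem_antidiagonal.1 hp]
  rw [e1, e2, ← Finset.sum_filter_add_sum_filter_not _ (fun p : ℕ × ℕ => p.1 + p.2 ≤ N),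
    add_sub_cancel_left]
  calc _ ≤ ∑ p ∈ (Finset.range (N + 1) ×ˢ Finset.range (N + 1)).filter
            (fun p => ¬ p.1 + p.2 ≤ N), |h p| := Finset.abs_sum_le_sum_abs _ _
    _ ≤ ∑ p ∈ (Finset.range (N + 1) ×ˢ Finset.range (N + 1)).filter
            (fun p => ¬ p.1 + p.2 ≤ N),
          ρ ^ (N + 1) * (|PowerSeries.coeff p.1 φ| * |PowerSeries.coeff p.2 ψ|) := by
        refine Finset.sum_le_sum fun p hp => ?_
        have hp2 : N + 1 ≤ p.1 + p.2 := by
          have := (Finset.mem_filter.1 hp).2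
          omega
        rw [hh]
        simp only [abs_mul, abs_pow, abs_of_nonneg h0]
        rw [mul_comm]
        exact mul_le_mul_of_nonneg_right (pow_le_pow_of_le_one h0 h1 hp2) (by positivity)
    _ ≤ ∑ p ∈ Finset.range (N + 1) ×ˢ Finset.range (N + 1),
          ρ ^ (N + 1) * (|PowerSeries.coeff p.1 φ| * |PowerSeries.coeff p.2 ψ|) :=
        Finset.sum_le_sum_of_subset_of_nonneg (Finset.filter_subset _ _)
          fun _ _ _ => by positivity
    _ = ρ ^ (N + 1) * (truncNorm N φ * truncNorm N ψ) := by
        rw [truncNorm, truncNorm, Finset.sum_mul_sum, Finset.sum_product]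
        simp only [Finset.mul_sum]

lemma abs_truncEval_le (N : ℕ) {ρ : ℝ} (h0 : 0 ≤ ρ) (h1 : ρ ≤ 1) (φ : PowerSeries ℝ) :
    |truncEval N ρ φ| ≤ truncNorm N φ := by
  refine (Finset.abs_sum_le_sum_abs _ _).trans (Finset.sum_le_sum fun j _ => ?_)
  rw [abs_mul, abs_pow, abs_of_nonneg h0]
  exact mul_le_of_le_one_right (abs_nonneg _) (pow_le_one₀ h0 h1)

lemma abs_truncEval_le_mul (N : ℕ) {ρ : ℝ} (h0 : 0 ≤ ρ) (h1 : ρ ≤ 1) (φ : PowerSeries ℝ)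
    (hφ : PowerSeries.coeff 0 φ = 0) : |truncEval N ρ φ| ≤ truncNorm N φ * ρ := by
  rw [truncNorm, Finset.sum_mul]
  refine (Finset.abs_sum_le_sum_abs _ _).trans (Finset.sum_le_sum fun j _ => ?_)
  rw [abs_mul, abs_pow, abs_of_nonneg h0]
  rcases j.eq_zero_or_pos with rfl | hj
  · rw [hφ]; simp
  · exact mul_le_mul_of_nonneg_left (pow_le_of_le_one h0 h1 hj.ne') (abs_nonneg _)

lemma truncNorm_one (N : ℕ) : truncNorm N 1 = 1 := by
  rw [truncNorm, Finset.sum_range_succ']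
  simp [PowerSeries.coeff_one]

lemma truncEval_one (N : ℕ) (ρ : ℝ) : truncEval N ρ 1 = 1 := by
  rw [truncEval, Finset.sum_range_succ']
  simp [PowerSeries.coeff_one]

lemma truncNorm_pow_le (N : ℕ) (φ : PowerSeries ℝ) (r : ℕ) :
    truncNorm N (φ ^ r) ≤ truncNorm N φ ^ r := by
  induction r with
  | zero => simp [truncNorm_one]
  | succ r ih =>
    rw [pow_succ, pow_succ]
    exact (truncNorm_mul_le N _ _).trans
      (mul_le_mul_of_nonneg_right ih (truncNorm_nonneg _ _))

lemma truncEval_expSeries (N : ℕ) (ρ u : ℝ) (P : PowerSeries ℝ) :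
    truncEval N ρ (expSeries N u P) =
      ∑ r ∈ Finset.range (N + 1), (-u) ^ r / (r.factorial : ℝ) * truncEval N ρ (P ^ r) := by
  simp only [truncEval, expSeries, map_sum, Finset.sum_mul, Finset.mul_sum]
  rw [Finset.sum_comm]
  refine Finset.sum_congr rfl fun r _ => Finset.sum_congr rfl fun j _ => ?_
  simp [mul_assoc]

lemma abs_neg_pow_div_factorial_le {u : ℝ} (hu : 0 ≤ u) (r : ℕ) :
    |(-u) ^ r / (r.factorial : ℝ)| ≤ u ^ r := by
  rw [abs_div, abs_pow, abs_neg, abs_of_nonneg hu, Nat.abs_cast]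
  exact div_le_self (by positivity) (by exact_mod_cast r.factorial_pos)

lemma truncNorm_expSeries_le (N : ℕ) {u K : ℝ} (hu : 0 ≤ u) (P : PowerSeries ℝ)
    (hP : truncNorm N P ≤ K) :
    truncNorm N (expSeries N u P) ≤ (1 + u) ^ N * ∑ r ∈ Finset.range (N + 1), K ^ r := by
  have hK : 0 ≤ K := (truncNorm_nonneg N P).trans hP
  calc truncNorm N (expSeries N u P)
      ≤ ∑ j ∈ Finset.range (N + 1), ∑ r ∈ Finset.range (N + 1),
          u ^ r * |PowerSeries.coeff j (P ^ r)| := by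
        refine Finset.sum_le_sum fun j _ => ?_
        rw [expSeries, map_sum]
        refine (Finset.abs_sum_le_sum_abs _ _).trans (Finset.sum_le_sum fun r _ => ?_)
        rw [map_smul, smul_eq_mul, abs_mul]
        exact mul_le_mul_of_nonneg_right (abs_neg_pow_div_factorial_le hu r) (abs_nonneg _)
    _ = ∑ r ∈ Finset.range (N + 1), u ^ r * truncNorm N (P ^ r) := by
        rw [Finset.sum_comm]
        simp only [truncNorm, Finset.mul_sum]
    _ ≤ ∑ r ∈ Finset.range (N + 1), (1 + u) ^ N * K ^ r := by
        refine Finset.sum_le_sum fun r hr => ?_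
        have h1 : truncNorm N (P ^ r) ≤ K ^ r :=
          (truncNorm_pow_le N P r).trans (pow_le_pow_left₀ (truncNorm_nonneg _ _) hP r)
        have h2 : u ^ r ≤ (1 + u) ^ N :=
          (pow_le_pow_left₀ hu (by linarith) r).trans
            (pow_le_pow_right₀ (by linarith) (by have := Finset.mem_range.1 hr; omega))
        exact mul_le_mul h2 h1 (truncNorm_nonneg _ _) (by positivity)
    _ = _ := by rw [Finset.mul_sum]

/-! ### Expansion of the exponential with `u` held fixed -/

lemma abs_exp_sub_sum_le (x : ℝ) (n : ℕ) :
    |Real.exp x - ∑ m ∈ Finset.range n, x ^ m / (m.factorial : ℝ)| ≤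
      |x| ^ n * Real.exp |x| := by
  have h := Complex.norm_exp_sub_sum_le_norm_mul_exp (x : ℂ) n
  rw [Complex.norm_real, Real.norm_eq_abs, ← Complex.ofReal_exp] at h
  rw [← Real.norm_eq_abs, ← Complex.norm_real]
  push_cast
  exact_mod_cast h

/-- Induction on `r`, splitting the error into that of `D^r`, that of `D`, and the truncation of a
product. The assumption `ρ ≤ η` turns the last one, of size `ρ^(N+1)`, into `η ρ^N`, so that all
errors have one common form. -/
lemma abs_pow_sub_truncEval_le (N : ℕ) {ρ η K D : ℝ} (P : PowerSeries ℝ)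
    (h0 : 0 ≤ ρ) (h1 : ρ ≤ 1) (hρη : ρ ≤ η) (hP : truncNorm N P ≤ K)
    (hDa : |D| ≤ K + 1) (hD : |D - truncEval N ρ P| ≤ η * ρ ^ N) (r : ℕ) :
    |D ^ r - truncEval N ρ (P ^ r)| ≤ η * ρ ^ N * (r * (K + 1) ^ r) := by
  have hK : 0 ≤ K := (truncNorm_nonneg N P).trans hP
  have hη : 0 ≤ η := h0.trans hρη
  induction r with
  | zero => simp [truncEval_one]
  | succ r ih =>
    have hPr : truncNorm N (P ^ r) ≤ K ^ r :=
      (truncNorm_pow_le N P r).trans (pow_le_pow_left₀ (truncNorm_nonneg _ _) hP r)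
    have e : D ^ (r + 1) - truncEval N ρ (P ^ (r + 1)) =
        D * (D ^ r - truncEval N ρ (P ^ r)) + (D - truncEval N ρ P) * truncEval N ρ (P ^ r) +
        (truncEval N ρ P * truncEval N ρ (P ^ r) - truncEval N ρ (P * P ^ r)) := by
      rw [← pow_succ']; ring
    have b1 : |D * (D ^ r - truncEval N ρ (P ^ r))| ≤
        (K + 1) * (η * ρ ^ N * (r * (K + 1) ^ r)) := by
      rw [abs_mul]; exact mul_le_mul hDa ih (abs_nonneg _) (by linarith)
    have b2 : |(D - truncEval N ρ P) * truncEval N ρ (P ^ r)| ≤ η * ρ ^ N * K ^ r := by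
      rw [abs_mul]
      exact mul_le_mul hD ((abs_truncEval_le N h0 h1 _).trans hPr) (abs_nonneg _) (by positivity)
    have b3 : |truncEval N ρ P * truncEval N ρ (P ^ r) - truncEval N ρ (P * P ^ r)| ≤
        η * ρ ^ N * (K * K ^ r) := by
      refine (abs_truncEval_mul_sub_le N h0 h1 _ _).trans ?_
      refine mul_le_mul ?_ (mul_le_mul hP hPr (truncNorm_nonneg _ _) hK)
        (mul_nonneg (truncNorm_nonneg _ _) (truncNorm_nonneg _ _)) (by positivity)
      rw [pow_succ, mul_comm]
      exact mul_le_mul_of_nonneg_right hρη (by positivity)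
    have hKr : K ^ r ≤ (K + 1) ^ r := pow_le_pow_left₀ hK (by linarith) r
    have b4 : η * ρ ^ N * (K ^ r * (K + 1)) ≤ η * ρ ^ N * ((K + 1) ^ r * (K + 1)) := by gcongr
    rw [e]
    refine (abs_add_three _ _ _).trans ((add_le_add (add_le_add b1 b2) b3).trans ?_)
    push_cast
    calc _ = η * ρ ^ N * (r * (K + 1) ^ (r + 1)) + η * ρ ^ N * (K ^ r * (K + 1)) := by ring
      _ ≤ η * ρ ^ N * (r * (K + 1) ^ (r + 1)) + η * ρ ^ N * ((K + 1) ^ r * (K + 1)) := by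
        linarith
      _ = _ := by ring

/-- The Taylor estimate for `exp (-u D)`, with all constants independent of `u`. -/
lemma exists_abs_exp_sub_truncEval_le {N : ℕ} (hN : 1 ≤ N) {K c : ℝ} (hK : 0 ≤ K) :
    ∃ C : ℝ, 0 ≤ C ∧ ∀ (P : PowerSeries ℝ) (D u ρ η : ℝ), PowerSeries.coeff 0 P = 0 →
      truncNorm N P ≤ K → 0 ≤ u → 0 ≤ ρ → ρ ≤ η → η ≤ 1 → (K + 1) * ρ ≤ c →
      |D - truncEval N ρ P| ≤ η * ρ ^ N →
      Real.exp (-u * D) ≤ Real.exp (c * u) ∧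
      |Real.exp (-u * D) - truncEval N ρ (expSeries N u P)| ≤
        C * (η * ρ ^ N * ((1 + u) ^ (N + 1) * Real.exp (c * u))) := by
  -- The sum bounds the errors in the powers `D^r`, and the last summand bounds the Taylor remainder
  -- of order `N + 1`.
  refine ⟨∑ r ∈ Finset.range (N + 1), (r * (K + 1) ^ r) + (K + 1) ^ (N + 1), by positivity, ?_⟩
  intro P D u ρ η hP0 hP hu h0 hρη hη1 hc hD
  have h1 : ρ ≤ 1 := hρη.trans hη1
  have hη : 0 ≤ η := h0.trans hρη
  -- `P` has no constant term, and `N ≥ 1` makes the error `η ρ^N` at most `ρ`. Hence `D = O(ρ)`,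
  -- and `(K + 1) ρ ≤ c` keeps `|u D|` below `c u`.
  have hDρ : |D| ≤ (K + 1) * ρ := by
    have a1 := abs_truncEval_le_mul N h0 h1 P hP0
    have a2 : truncNorm N P * ρ ≤ K * ρ := mul_le_mul_of_nonneg_right hP h0
    have a3 : η * ρ ^ N ≤ 1 * ρ :=
      mul_le_mul hη1 (pow_le_of_le_one h0 h1 (by omega)) (by positivity) zero_le_one
    have a4 : |D| ≤ |D - truncEval N ρ P| + |truncEval N ρ P| := by
      simpa using abs_add_le (D - truncEval N ρ P) (truncEval N ρ P)
    linarith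
  have hDa : |D| ≤ K + 1 := hDρ.trans (mul_le_of_le_one_right (by linarith) h1)
  have huD : |-u * D| ≤ c * u := by
    rw [abs_mul, abs_neg, abs_of_nonneg hu, mul_comm]
    exact mul_le_mul_of_nonneg_right (hDρ.trans hc) hu
  refine ⟨Real.exp_le_exp.2 ((le_abs_self _).trans huD), ?_⟩
  have hcu : 0 ≤ c * u := (abs_nonneg _).trans huD
  have hexp1 : 1 ≤ Real.exp (c * u) := Real.one_le_exp hcu
  set W := η * ρ ^ N * ((1 + u) ^ (N + 1) * Real.exp (c * u)) with hW
  have t1 : |Real.exp (-u * D) - ∑ r ∈ Finset.range (N + 1), (-u * D) ^ r / (r.factorial : ℝ)| ≤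
      (K + 1) ^ (N + 1) * W := by
    refine (abs_exp_sub_sum_le _ _).trans ?_
    have a1 : |-u * D| ^ (N + 1) ≤ ((1 + u) * ((K + 1) * ρ)) ^ (N + 1) := by
      refine pow_le_pow_left₀ (abs_nonneg _) ?_ _
      rw [abs_mul, abs_neg, abs_of_nonneg hu]
      exact mul_le_mul (by linarith) hDρ (abs_nonneg _) (by linarith)
    have a2 : Real.exp |-u * D| ≤ Real.exp (c * u) := Real.exp_le_exp.2 huD
    refine (mul_le_mul a1 a2 (Real.exp_pos _).le (by positivity)).trans ?_
    have a3 : ρ ^ (N + 1) ≤ η * ρ ^ N := by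
      rw [pow_succ, mul_comm]; exact mul_le_mul_of_nonneg_right hρη (by positivity)
    calc _ = (K + 1) ^ (N + 1) * (ρ ^ (N + 1) * ((1 + u) ^ (N + 1) * Real.exp (c * u))) := by
          rw [mul_pow, mul_pow]; ring
      _ ≤ _ := by rw [hW]; gcongr
  have t2 : |∑ r ∈ Finset.range (N + 1), (-u * D) ^ r / (r.factorial : ℝ) -
      truncEval N ρ (expSeries N u P)| ≤
      (∑ r ∈ Finset.range (N + 1), (r * (K + 1) ^ r)) * W := by
    rw [truncEval_expSeries, ← Finset.sum_sub_distrib, Finset.sum_mul]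
    refine (Finset.abs_sum_le_sum_abs _ _).trans (Finset.sum_le_sum fun r hr => ?_)
    have e : (-u * D) ^ r / (r.factorial : ℝ) -
        (-u) ^ r / (r.factorial : ℝ) * truncEval N ρ (P ^ r) =
        (-u) ^ r / (r.factorial : ℝ) * (D ^ r - truncEval N ρ (P ^ r)) := by
      rw [mul_pow]; ring
    rw [e, abs_mul]
    have a1 : u ^ r ≤ (1 + u) ^ (N + 1) * Real.exp (c * u) := by
      calc u ^ r ≤ (1 + u) ^ r := pow_le_pow_left₀ hu (by linarith) r
        _ ≤ (1 + u) ^ (N + 1) :=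
          pow_le_pow_right₀ (by linarith) (by have := Finset.mem_range.1 hr; omega)
        _ ≤ _ := le_mul_of_one_le_right (by positivity) hexp1
    refine (mul_le_mul ((abs_neg_pow_div_factorial_le hu r).trans a1)
      (abs_pow_sub_truncEval_le N P h0 h1 hρη hP hDa hD r) (abs_nonneg _)
      (by positivity)).trans (le_of_eq ?_)
    rw [hW]; ring
  calc _ ≤ _ := abs_sub_le _ (∑ r ∈ Finset.range (N + 1), (-u * D) ^ r / (r.factorial : ℝ)) _
    _ ≤ (K + 1) ^ (N + 1) * W + (∑ r ∈ Finset.range (N + 1), (r * (K + 1) ^ r)) * W :=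
      add_le_add t1 t2
    _ = _ := by ring

/-- The same estimate for the product of `exp (-u D)` with a second expansion. -/
lemma exists_abs_exp_mul_sub_truncEval_le {N : ℕ} (hN : 1 ≤ N) {K c : ℝ} (hK : 0 ≤ K) :
    ∃ C : ℝ, 0 ≤ C ∧ ∀ (P Q : PowerSeries ℝ) (D G u ρ η : ℝ), PowerSeries.coeff 0 P = 0 →
      truncNorm N P ≤ K → 0 ≤ u → 0 ≤ ρ → ρ ≤ η → η ≤ 1 → (K + 1) * ρ ≤ c →
      |D - truncEval N ρ P| ≤ η * ρ ^ N → |G - truncEval N ρ Q| ≤ η * ρ ^ N →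
      |Real.exp (-u * D) * G - truncEval N ρ (expSeries N u P * Q)| ≤
        C * (η * ρ ^ N * ((1 + u) ^ (N + 1) * Real.exp (c * u)) * (1 + truncNorm N Q)) := by
  obtain ⟨C₁, hC₁, H⟩ := exists_abs_exp_sub_truncEval_le hN (c := c) hK
  -- The summands pay for the error in `G`, the error in the exponential, and the truncation of
  -- their product, in that order.
  refine ⟨1 + C₁ + ∑ r ∈ Finset.range (N + 1), K ^ r, by positivity, ?_⟩
  intro P Q D G u ρ η hP0 hP hu h0 hρη hη1 hc hD hG
  obtain ⟨H1, H2⟩ := H P D u ρ η hP0 hP hu h0 hρη hη1 hc hD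
  have h1 : ρ ≤ 1 := hρη.trans hη1
  have hη : 0 ≤ η := h0.trans hρη
  have hc0 : 0 ≤ c := le_trans (by positivity) hc
  have hexp1 : 1 ≤ Real.exp (c * u) := Real.one_le_exp (by positivity)
  have hu1 : (1 : ℝ) ≤ (1 + u) ^ (N + 1) := one_le_pow₀ (by linarith)
  set W := η * ρ ^ N * ((1 + u) ^ (N + 1) * Real.exp (c * u)) with hW
  have hW0 : 0 ≤ W := by positivity
  have hB := truncNorm_nonneg N Q
  set S := ∑ r ∈ Finset.range (N + 1), K ^ r with hS
  have hS0 : 0 ≤ S := by positivity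
  have e : Real.exp (-u * D) * G - truncEval N ρ (expSeries N u P * Q) =
      Real.exp (-u * D) * (G - truncEval N ρ Q) +
      (Real.exp (-u * D) - truncEval N ρ (expSeries N u P)) * truncEval N ρ Q +
      (truncEval N ρ (expSeries N u P) * truncEval N ρ Q -
        truncEval N ρ (expSeries N u P * Q)) := by ring
  have b1 : |Real.exp (-u * D) * (G - truncEval N ρ Q)| ≤ W := by
    rw [abs_mul, Real.abs_exp]
    calc _ ≤ Real.exp (c * u) * (η * ρ ^ N) :=
          mul_le_mul H1 hG (abs_nonneg _) (Real.exp_pos _).le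
      _ ≤ ((1 + u) ^ (N + 1) * Real.exp (c * u)) * (η * ρ ^ N) := by
          gcongr; exact le_mul_of_one_le_left (Real.exp_pos _).le hu1
      _ = W := by rw [hW]; ring
  have b2 : |(Real.exp (-u * D) - truncEval N ρ (expSeries N u P)) * truncEval N ρ Q| ≤
      C₁ * W * truncNorm N Q := by
    rw [abs_mul]
    exact mul_le_mul H2 (abs_truncEval_le N h0 h1 Q) (abs_nonneg _) (by positivity)
  have b3 : |truncEval N ρ (expSeries N u P) * truncEval N ρ Q -
        truncEval N ρ (expSeries N u P * Q)| ≤ S * W * truncNorm N Q := by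
    refine (abs_truncEval_mul_sub_le N h0 h1 _ _).trans ?_
    have a1 := truncNorm_expSeries_le N hu P hP
    have a3 : ρ ^ (N + 1) ≤ η * ρ ^ N := by
      rw [pow_succ, mul_comm]; exact mul_le_mul_of_nonneg_right hρη (by positivity)
    have a4 : (1 + u) ^ N ≤ (1 + u) ^ (N + 1) * Real.exp (c * u) :=
      (pow_le_pow_right₀ (by linarith) (by omega)).trans
        (le_mul_of_one_le_right (by positivity) hexp1)
    calc _ ≤ (η * ρ ^ N) * (((1 + u) ^ (N + 1) * Real.exp (c * u)) * S * truncNorm N Q) := by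
          refine mul_le_mul a3 (mul_le_mul_of_nonneg_right (a1.trans ?_) hB)
            (mul_nonneg (truncNorm_nonneg _ _) hB) (by positivity)
          exact mul_le_mul_of_nonneg_right a4 hS0
      _ = _ := by rw [hW]; ring
  rw [e]
  refine (abs_add_three _ _ _).trans ((add_le_add (add_le_add b1 b2) b3).trans ?_)
  nlinarith [mul_nonneg hC₁ hW0, mul_nonneg hS0 hW0, mul_nonneg hW0 hB]

/-! ### Bell polynomials as coefficients of powers -/

lemma sum_antidiagonalTuple_prod (p : ℕ → ℝ) (r m : ℕ) :
    ∑ n ∈ Finset.Nat.antidiagonalTuple r m, ∏ i, p (n i) =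
      PowerSeries.coeff m (PowerSeries.mk p ^ r) := by
  induction r generalizing m with
  | zero =>
    cases m with
    | zero => simp
    | succ m => simp [PowerSeries.coeff_one]
  | succ r ih =>
    rw [pow_succ', PowerSeries.coeff_mul]
    simp only [← ih, Finset.mul_sum, PowerSeries.coeff_mk]
    rw [Finset.sum_sigma']
    refine (Finset.sum_bij' (fun x _ => (Fin.cons x.1.1 x.2 : Fin (r + 1) → ℕ))
      (fun n _ => ⟨(n 0, ∑ i, Fin.tail n i), Fin.tail n⟩) ?_ ?_ ?_ ?_ ?_).symm
    · rintro ⟨⟨a, b⟩, x⟩ h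
      simp only [Finset.mem_sigma, Finset.HasAntidiagonal.mem_antidiagonal,
        Finset.Nat.mem_antidiagonalTuple] at h ⊢
      rw [Fin.sum_cons, h.2, h.1]
    · intro n h
      simp only [Finset.mem_sigma, Finset.HasAntidiagonal.mem_antidiagonal,
        Finset.Nat.mem_antidiagonalTuple] at h ⊢
      refine ⟨?_, trivial⟩
      rw [← h, Fin.sum_univ_succ]; rfl
    · rintro ⟨⟨a, b⟩, x⟩ h
      simp only [Finset.mem_sigma, Finset.HasAntidiagonal.mem_antidiagonal,
        Finset.Nat.mem_antidiagonalTuple] at h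
      obtain ⟨_, rfl⟩ := h
      simp
    · intro n h
      simp
    · rintro ⟨⟨a, b⟩, x⟩ h
      simp [Fin.prod_univ_succ]

/-- The power series with the given coefficients in positive degrees, and no constant term. -/
noncomputable def posSeries (a : ℕ → ℝ) : PowerSeries ℝ :=
  PowerSeries.mk fun i => if i = 0 then 0 else a i

/-- Removing the constant term kills exactly the tuples with a zero entry, which is the condition
`n_i ≥ 1` in `bell`. -/
lemma coeff_posSeries_pow (a : ℕ → ℝ) (m r : ℕ) :
    PowerSeries.coeff m (posSeries a ^ r) = bell a m r := by
  rw [posSeries, ← sum_antidiagonalTuple_prod, bell, Finset.sum_filter]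
  refine Finset.sum_congr rfl fun n _ => ?_
  split_ifs with h
  · exact Finset.prod_congr rfl fun i _ => if_neg (by have := h i; omega)
  · push Not at h
    obtain ⟨i, hi⟩ := h
    exact Finset.prod_eq_zero (Finset.mem_univ i) (if_pos (by omega))

lemma bell_eq_zero_of_lt (a : ℕ → ℝ) {m r : ℕ} (h : m < r) : bell a m r = 0 := by
  refine Finset.sum_eq_zero fun n hn => ?_
  rw [Finset.mem_filter, Finset.Nat.mem_antidiagonalTuple] at hn
  have : ∑ _i : Fin r, 1 ≤ ∑ i, n i := Finset.sum_le_sum fun i _ => hn.2 i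
  simp at this
  omega

lemma bell_zero_right (a : ℕ → ℝ) (m : ℕ) : bell a m 0 = if m = 0 then 1 else 0 := by
  rw [← coeff_posSeries_pow, pow_zero, PowerSeries.coeff_one]

/-- The range of `r` can be made independent of `m`: terms with `r > m` vanish, and `r = 0`
contributes only for `m = 0`, where it gives the conventional value `1`. -/
lemma innerSum_eq (s : ℝ) (a : ℕ → ℝ) {m N : ℕ} (hm : m ≤ N) :
    innerSum s a m =
      ∑ r ∈ Finset.range (N + 1), genBinom (-s) r * (bell a m r / a 0 ^ r) := by
  rw [innerSum]
  split_ifs with h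
  · subst h
    rw [Finset.sum_range_succ', Finset.sum_eq_zero]
    · simp [genBinom, bell_zero_right]
    · intro r _
      rw [bell_eq_zero_of_lt a (Nat.succ_pos r)]; simp
  · refine Finset.sum_subset (fun r hr => ?_) fun r hr hr' => ?_
    · simp only [Finset.mem_Icc, Finset.mem_range] at *; omega
    · simp only [Finset.mem_Icc, Finset.mem_range, not_and, not_le] at *
      rcases r.eq_zero_or_pos with rfl | hr0
      · rw [bell_zero_right, if_neg h]; simp
      · rw [bell_eq_zero_of_lt a (hr' hr0)]; simp

/-! ### Gamma integrals of the model coefficients -/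

/-- The coefficient of `ρ^j` in the expansion of `exp (-u ∑ a_i ρ^i) * ∑ b_i ρ^i` at fixed `u`. -/
noncomputable def expCoeff (N : ℕ) (a b : ℕ → ℝ) (j : ℕ) (u : ℝ) : ℝ :=
  Real.exp (-u * a 0) *
    PowerSeries.coeff j (expSeries N u (posSeries a) * PowerSeries.mk b)

lemma expCoeff_eq (N : ℕ) (a b : ℕ → ℝ) (j : ℕ) (u : ℝ) :
    expCoeff N a b j u = ∑ m ∈ Finset.range (j + 1), ∑ r ∈ Finset.range (N + 1),
      b (j - m) * ((-1) ^ r / (r.factorial : ℝ) * bell a m r) *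
        (u ^ r * Real.exp (-u * a 0)) := by
  rw [expCoeff, PowerSeries.coeff_mul,
    Finset.Nat.sum_antidiagonal_eq_sum_range_succ (fun x y =>
      PowerSeries.coeff x (expSeries N u (posSeries a)) * PowerSeries.coeff y (PowerSeries.mk b)),
    Finset.mul_sum]
  refine Finset.sum_congr rfl fun m _ => ?_
  rw [expSeries, map_sum, PowerSeries.coeff_mk, Finset.sum_mul, Finset.mul_sum]
  refine Finset.sum_congr rfl fun r _ => ?_
  rw [map_smul, smul_eq_mul, coeff_posSeries_pow, neg_pow]
  ring

lemma rpow_mul_pow_mul_exp_eq {k ν x : ℝ} (q a₀ : ℝ) (r : ℕ) (hx : 0 < x) :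
    x ^ q * ((k * x ^ ν) ^ r * Real.exp (-(k * x ^ ν) * a₀)) =
      k ^ r * (x ^ (q + ν * r) * Real.exp (-(k * a₀) * x ^ ν)) := by
  rw [Real.rpow_add hx, Real.rpow_mul hx.le, Real.rpow_natCast, mul_pow,
    show -(k * x ^ ν) * a₀ = -(k * a₀) * x ^ ν by ring]
  ring

lemma integrableOn_rpow_mul_pow_mul_exp {k ν a₀ q : ℝ} (hk : 0 < k) (hν : 0 < ν) (ha : 0 < a₀)
    (hq : -1 < q) (r : ℕ) :
    IntegrableOn (fun x : ℝ => x ^ q * ((k * x ^ ν) ^ r * Real.exp (-(k * x ^ ν) * a₀)))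
      (Set.Ioi 0) := by
  have h1 : -1 < q + ν * r := by nlinarith [mul_nonneg hν.le r.cast_nonneg (α := ℝ)]
  have h2 : IntegrableOn (fun x : ℝ => k ^ r * (x ^ (q + ν * r) * Real.exp (-(k * a₀) * x ^ ν)))
      (Set.Ioi 0) :=
    (integrableOn_rpow_mul_exp_neg_mul_rpow h1 hν (mul_pos hk ha)).const_mul _
  refine h2.congr_fun (fun x hx => ?_) measurableSet_Ioi
  exact (rpow_mul_pow_mul_exp_eq q a₀ r hx).symm

lemma integral_rpow_mul_pow_mul_exp {k ν a₀ q s : ℝ} (hk : 0 < k) (hν : 0 < ν) (ha : 0 < a₀)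
    (hs : 0 < s) (hqs : (q + 1) / ν = s) (r : ℕ) :
    ∫ x in Set.Ioi (0 : ℝ), x ^ q * ((k * x ^ ν) ^ r * Real.exp (-(k * x ^ ν) * a₀)) =
      k ^ (-s) * (1 / ν) * (a₀ ^ (-s) / a₀ ^ r) * Real.Gamma (s + r) := by
  have hq : q = s * ν - 1 := by rw [← hqs]; field_simp; ring
  have hq1 : -1 < q := by rw [hq]; nlinarith
  have h1 : -1 < q + ν * r := by nlinarith [mul_nonneg hν.le r.cast_nonneg (α := ℝ)]
  have e : (q + ν * r + 1) / ν = s + r := by rw [hq]; field_simp; ring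
  rw [setIntegral_congr_fun measurableSet_Ioi fun x hx => rpow_mul_pow_mul_exp_eq q a₀ r hx,
    integral_const_mul, integral_rpow_mul_exp_neg_mul_rpow hν h1 (mul_pos hk ha), neg_div, e,
    Real.mul_rpow hk.le ha.le, neg_add, Real.rpow_add hk, Real.rpow_add ha, Real.rpow_neg hk.le r,
    Real.rpow_neg ha.le r, Real.rpow_natCast, Real.rpow_natCast]
  have := pow_pos hk r
  field_simp

/-- `Γ(s+r)/Γ(s)` is the rising factorial `s(s+1)⋯(s+r-1)`, which is `(-1)^r` times the falling
factorial of `-s`. -/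
lemma Gamma_add_nat_eq {s : ℝ} (hs : 0 < s) (r : ℕ) :
    (-1) ^ r / (r.factorial : ℝ) * Real.Gamma (s + r) = Real.Gamma s * genBinom (-s) r := by
  have h : (-1) ^ r * Real.Gamma (s + r) =
      Real.Gamma s * ∏ i ∈ Finset.range r, (-s - (i : ℝ)) := by
    induction r with
    | zero => simp
    | succ r ih =>
      rw [Finset.prod_range_succ, ← mul_assoc, ← ih]
      push_cast
      rw [← add_assoc, Real.Gamma_add_one (by positivity)]
      ring
  rw [genBinom, ← mul_div_assoc, ← h]; ring

/-- The factor `k^r` in `u^r` cancels against the scaling `k^(-(s+r))` of the Gamma integral, so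
every term of the `j`-th coefficient has the same power `k^(-s)`, with `s = (j+λ)/ν`. -/
lemma integral_rpow_mul_expCoeff {k ν lam : ℝ} {N : ℕ} {a : ℕ → ℝ} (b : ℕ → ℝ) {j : ℕ}
    (hj : j ≤ N) (hk : 0 < k) (hν : 0 < ν) (ha : 0 < a 0) (hlam : 0 < lam) :
    ∫ x in Set.Ioi (0 : ℝ), x ^ ((j : ℝ) + lam - 1) * expCoeff N a b j (k * x ^ ν) =
      1 / ν * Real.Gamma (((j : ℝ) + lam) / ν) * coeffIntegrand ν lam a b j *
        k ^ (-(((j : ℝ) + lam) / ν)) := by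
  set s := ((j : ℝ) + lam) / ν with hs
  have hjl : 0 < (j : ℝ) + lam := by positivity
  have hs0 : 0 < s := by positivity
  have hq : -1 < (j : ℝ) + lam - 1 := by linarith
  have hqs : ((j : ℝ) + lam - 1 + 1) / ν = s := by rw [hs]; ring
  have e : ∀ x : ℝ, x ^ ((j : ℝ) + lam - 1) * expCoeff N a b j (k * x ^ ν) =
      ∑ m ∈ Finset.range (j + 1), ∑ r ∈ Finset.range (N + 1),
      b (j - m) * ((-1) ^ r / (r.factorial : ℝ) * bell a m r) * (x ^ ((j : ℝ) + lam - 1) *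
        ((k * x ^ ν) ^ r * Real.exp (-(k * x ^ ν) * a 0))) := by
    intro x
    simp only [expCoeff_eq, Finset.mul_sum]
    refine Finset.sum_congr rfl fun m _ => Finset.sum_congr rfl fun r _ => ?_
    ring
  have hi : ∀ m r, Integrable (fun x : ℝ =>
      b (j - m) * ((-1) ^ r / (r.factorial : ℝ) * bell a m r) * (x ^ ((j : ℝ) + lam - 1) *
        ((k * x ^ ν) ^ r * Real.exp (-(k * x ^ ν) * a 0)))) (volume.restrict (Set.Ioi 0)) :=
    fun m r => (integrableOn_rpow_mul_pow_mul_exp hk hν ha hq r).const_mul _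
  simp only [e]
  rw [integral_finsetSum _ fun m _ => integrable_finsetSum _ fun r _ => hi m r]
  rw [coeffIntegrand, ← hs, Finset.mul_sum, Finset.mul_sum, Finset.sum_mul]
  refine Finset.sum_congr rfl fun m hm => ?_
  rw [integral_finsetSum _ fun r _ => hi m r,
    innerSum_eq s a (show m ≤ N by have := Finset.mem_range.1 hm; omega)]
  simp only [Finset.mul_sum, Finset.sum_mul]
  refine Finset.sum_congr rfl fun r _ => ?_
  rw [integral_const_mul, integral_rpow_mul_pow_mul_exp hk hν ha hs0 hqs]
  calc _ = b (j - m) * bell a m r * (k ^ (-s) * (1 / ν) * (a 0 ^ (-s) / a 0 ^ r)) *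
        ((-1) ^ r / (r.factorial : ℝ) * Real.Gamma (s + r)) := by ring
    _ = _ := by rw [Gamma_add_nat_eq hs0]; ring

lemma exists_pow_mul_exp_le (M : ℕ) {c : ℝ} (hc : 0 < c) :
    ∃ C : ℝ, 0 ≤ C ∧ ∀ u : ℝ, 0 ≤ u → (1 + u) ^ M ≤ C * Real.exp (c * u) := by
  -- From `y^M / M! ≤ e^y` at `y = c (1 + u)`.
  refine ⟨M.factorial / c ^ M * Real.exp c, by positivity, fun u hu => ?_⟩
  have h := Real.pow_div_factorial_le_exp (c * (1 + u)) (by positivity) M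
  rw [div_le_iff₀ (by positivity), mul_pow, mul_add, mul_one, Real.exp_add] at h
  have hcM : 0 < c ^ M := by positivity
  calc (1 + u) ^ M = c ^ M * (1 + u) ^ M / c ^ M := by field_simp
    _ ≤ (Real.exp c * Real.exp (c * u) * M.factorial) / c ^ M := by gcongr
    _ = _ := by ring

/-! ### Polar coordinates -/

lemma integrable_volumeIoiPow_iff (n : ℕ) (h : ℝ → ℝ) :
    Integrable (fun x : Set.Ioi (0 : ℝ) => h x) (Measure.volumeIoiPow n) ↔
      IntegrableOn (fun x : ℝ => x ^ n * h x) (Set.Ioi 0) := by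
  rw [integrableOn_iff_comap_subtypeVal measurableSet_Ioi, Measure.volumeIoiPow,
    integrable_withDensity_iff_integrable_smul' (by fun_prop) (by simp)]
  refine integrable_congr (ae_of_all _ ?_)
  rintro ⟨x, hx : 0 < x⟩
  simp (disch := positivity) [ENNReal.toReal_ofReal]

lemma integral_volumeIoiPow (n : ℕ) (h : ℝ → ℝ) :
    ∫ x : Set.Ioi (0 : ℝ), h x ∂(Measure.volumeIoiPow n) =
      ∫ x in Set.Ioi (0 : ℝ), x ^ n * h x := by
  rw [Measure.volumeIoiPow, integral_withDensity_eq_integral_toReal_smul (by fun_prop) (by simp),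
    integral_subtype_comap measurableSet_Ioi
      fun x : ℝ => (ENNReal.ofReal (x ^ n)).toReal • h x]
  refine setIntegral_congr_fun measurableSet_Ioi fun x hx => ?_
  have hx : 0 < x := hx
  simp (disch := positivity) [ENNReal.toReal_ofReal]

variable {d : ℕ}

/-- The measure `ρ^{d-1} dρ dΩ` on `S^{d-1} × (0, ∞)`. -/
noncomputable def polarMeasure (d : ℕ) : Measure (USphere d × Set.Ioi (0 : ℝ)) :=
  (surfaceMeasure d).prod (Measure.volumeIoiPow (d - 1))

instance (d : ℕ) : IsFiniteMeasure (surfaceMeasure d) := by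
  unfold surfaceMeasure; infer_instance

/-- The point `ρ Ω` with polar coordinates `(Ω, ρ)`. -/
noncomputable def polarPoint (p : USphere d × Set.Ioi (0 : ℝ)) : EuclideanSpace ℝ (Fin d) :=
  (p.2 : ℝ) • (p.1 : EuclideanSpace ℝ (Fin d))

lemma norm_polarPoint (p : USphere d × Set.Ioi (0 : ℝ)) : ‖polarPoint p‖ = p.2 := by
  have h : (0 : ℝ) < p.2 := p.2.2
  rw [polarPoint, norm_smul, norm_eq_of_mem_sphere p.1, mul_one, Real.norm_eq_abs, abs_of_pos h]

lemma polarPoint_homeomorph (x : ({0}ᶜ : Set (EuclideanSpace ℝ (Fin d)))) :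
    polarPoint (homeomorphUnitSphereProd (EuclideanSpace ℝ (Fin d)) x) = x := by
  have h : ‖(x : EuclideanSpace ℝ (Fin d))‖ ≠ 0 := norm_ne_zero_iff.2 x.2
  simp [polarPoint, smul_smul, h]

lemma measurePreserving_polar (d : ℕ) :
    MeasurePreserving (homeomorphUnitSphereProd (EuclideanSpace ℝ (Fin d)))
      ((volume : Measure (EuclideanSpace ℝ (Fin d))).comap (↑)) (polarMeasure d) := by
  simpa [polarMeasure, surfaceMeasure] using
    (volume : Measure (EuclideanSpace ℝ (Fin d))).measurePreserving_homeomorphUnitSphereProd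

lemma integrable_comp_polarPoint_iff (hd : 1 ≤ d) (φ : EuclideanSpace ℝ (Fin d) → ℝ) :
    Integrable (fun p => φ (polarPoint p)) (polarMeasure d) ↔ Integrable φ := by
  have : Nonempty (Fin d) := ⟨⟨0, hd⟩⟩
  rw [← (measurePreserving_polar d).integrable_comp_emb (Homeomorph.measurableEmbedding _)]
  simp only [Function.comp_def, polarPoint_homeomorph]
  -- Polar coordinates miss only the origin, which is a null set because `d ≥ 1`.
  rw [← restrict_compl_singleton (μ := (volume : Measure (EuclideanSpace ℝ (Fin d)))) 0,
    ← IntegrableOn, integrableOn_iff_comap_subtypeVal (measurableSet_singleton _).compl,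
    Function.comp_def, restrict_compl_singleton]

lemma integral_comp_polarPoint (hd : 1 ≤ d) (φ : EuclideanSpace ℝ (Fin d) → ℝ) :
    ∫ p, φ (polarPoint p) ∂(polarMeasure d) = ∫ x, φ x := by
  have : Nonempty (Fin d) := ⟨⟨0, hd⟩⟩
  rw [← (measurePreserving_polar d).integral_comp (Homeomorph.measurableEmbedding _)]
  simp only [polarPoint_homeomorph]
  rw [integral_subtype_comap (measurableSet_singleton _).compl φ, restrict_compl_singleton]

/-! ### Uniform estimates over the sphere -/

lemma exists_abs_le_of_continuous {φ : USphere d → ℝ} (h : Continuous φ) :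
    ∃ M : ℝ, 0 < M ∧ ∀ Ω, |φ Ω| ≤ M := by
  obtain ⟨M, hM⟩ := isCompact_univ.exists_bound_of_continuousOn h.continuousOn
  exact ⟨max M 1, by positivity, fun Ω => (hM Ω (Set.mem_univ _)).trans (le_max_left _ _)⟩

lemma continuous_coeff_posSeries {N j : ℕ} {fc : ℕ → USphere d → ℝ}
    (hfc : ∀ j ≤ N, Continuous (fc j)) (hj : j ≤ N) :
    Continuous fun Ω => PowerSeries.coeff j (posSeries fun i => fc i Ω) := by
  simp only [posSeries, PowerSeries.coeff_mk]
  split_ifs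
  · exact continuous_const
  · exact hfc j hj

lemma continuous_bell {N m : ℕ} {fc : ℕ → USphere d → ℝ}
    (hfc : ∀ j ≤ N, Continuous (fc j)) (hm : m ≤ N) (r : ℕ) :
    Continuous fun Ω => bell (fun i => fc i Ω) m r := by
  refine continuous_finsetSum _ fun n hn => continuous_finsetProd _ fun i _ => hfc _ ?_
  rw [Finset.mem_filter, Finset.Nat.mem_antidiagonalTuple] at hn
  calc n i ≤ ∑ i, n i := Finset.single_le_sum (fun _ _ => Nat.zero_le _) (Finset.mem_univ i)
    _ ≤ N := hn.1.trans_le hm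

lemma continuous_innerSum {N m : ℕ} {fc : ℕ → USphere d → ℝ}
    (hfc : ∀ j ≤ N, Continuous (fc j)) (hfc0 : ∀ Ω, 0 < fc 0 Ω) (hm : m ≤ N) (s : ℝ) :
    Continuous fun Ω => innerSum s (fun i => fc i Ω) m := by
  simp only [innerSum_eq s _ hm]
  refine continuous_finsetSum _ fun r _ => continuous_const.mul ?_
  exact (continuous_bell hfc hm r).div₀ ((hfc 0 (Nat.zero_le _)).pow r)
    fun Ω => (pow_pos (hfc0 Ω) r).ne'

/-- The integrable majorant `1 + ∑_{j ≤ N} |g_j(Ω)|` on the sphere. -/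
noncomputable def sphereBound (N : ℕ) (gc : ℕ → USphere d → ℝ) (Ω : USphere d) : ℝ :=
  1 + truncNorm N (PowerSeries.mk fun i => gc i Ω)

lemma sphereBound_nonneg (N : ℕ) (gc : ℕ → USphere d → ℝ) (Ω : USphere d) :
    0 ≤ sphereBound N gc Ω := by
  have := truncNorm_nonneg N (PowerSeries.mk fun i => gc i Ω)
  unfold sphereBound; linarith

lemma exists_abs_expCoeff_le {N : ℕ} {fc : ℕ → USphere d → ℝ} (gc : ℕ → USphere d → ℝ)
    {K c : ℝ} (hc : 0 < c) (hK : ∀ Ω, truncNorm N (posSeries fun i => fc i Ω) ≤ K)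
    (hK0 : 0 ≤ K) (hcf : ∀ Ω, 3 * c ≤ fc 0 Ω) :
    ∃ C : ℝ, 0 ≤ C ∧ ∀ Ω, ∀ j ≤ N, ∀ u : ℝ, 0 ≤ u →
      |expCoeff N (fun i => fc i Ω) (fun i => gc i Ω) j u| ≤
        C * (Real.exp (-c * u) * sphereBound N gc Ω) := by
  obtain ⟨C, hC, hCu⟩ := exists_pow_mul_exp_le N hc
  set S := ∑ r ∈ Finset.range (N + 1), K ^ r with hS
  have hS0 : 0 ≤ S := by positivity
  refine ⟨C * S, by positivity, fun Ω j hj u hu => ?_⟩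
  have h1 : |PowerSeries.coeff j (expSeries N u (posSeries fun i => fc i Ω) *
      PowerSeries.mk fun i => gc i Ω)| ≤ (C * Real.exp (c * u)) * S * sphereBound N gc Ω := by
    calc _ ≤ truncNorm N (expSeries N u (posSeries fun i => fc i Ω) *
          PowerSeries.mk fun i => gc i Ω) :=
          Finset.single_le_sum (f := fun j => |PowerSeries.coeff j
            (expSeries N u (posSeries fun i => fc i Ω) * PowerSeries.mk fun i => gc i Ω)|)
            (fun _ _ => abs_nonneg _) (Finset.mem_range.2 (Nat.lt_succ_of_le hj))
      _ ≤ _ := truncNorm_mul_le _ _ _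
      _ ≤ _ := by
        refine mul_le_mul ((truncNorm_expSeries_le N hu _ (hK Ω)).trans
          (mul_le_mul_of_nonneg_right (hCu u hu) hS0)) ?_ (truncNorm_nonneg _ _) (by positivity)
        unfold sphereBound; linarith
  have h2 : Real.exp (-u * fc 0 Ω) ≤ Real.exp (-c * u) * Real.exp (-(c * u)) := by
    rw [← Real.exp_add]
    refine Real.exp_le_exp.2 ?_
    nlinarith [mul_le_mul_of_nonneg_left (hcf Ω) hu, mul_nonneg hc.le hu]
  rw [expCoeff, abs_mul, Real.abs_exp]
  refine (mul_le_mul h2 h1 (abs_nonneg _) (by positivity)).trans (le_of_eq ?_)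
  rw [Real.exp_neg (c * u)]
  field_simp

/-- The remainder estimate in the integrand, uniform in `k` and in the direction. -/
lemma exists_integrand_estimate {N : ℕ} (hN : 1 ≤ N) {ν p : ℝ}
    {f g : EuclideanSpace ℝ (Fin d) → ℝ} {fc gc : ℕ → USphere d → ℝ}
    (hfc : ∀ j ≤ N, Continuous (fc j)) (hfc0 : ∀ Ω, 0 < fc 0 Ω)
    (hfexp : HasRadialExpansion f ν N fc) (hgexp : HasRadialExpansion g p N gc) :
    ∃ C c : ℝ, 0 ≤ C ∧ 0 < c ∧
      (∀ Ω, ∀ j ≤ N, ∀ u : ℝ, 0 ≤ u →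
        |expCoeff N (fun i => fc i Ω) (fun i => gc i Ω) j u| ≤
          C * (Real.exp (-c * u) * sphereBound N gc Ω)) ∧
      ∀ η : ℝ, 0 < η → η ≤ 1 → ∃ δ : ℝ, 0 < δ ∧ ∀ k : ℝ, 0 < k → ∀ ρ : ℝ, 0 < ρ → ρ < δ →
        ∀ Ω : USphere d,
        |Real.exp (-k * f (ρ • (Ω : EuclideanSpace ℝ (Fin d)))) *
            g (ρ • (Ω : EuclideanSpace ℝ (Fin d))) -
          ρ ^ p * ∑ j ∈ Finset.range (N + 1),
            expCoeff N (fun i => fc i Ω) (fun i => gc i Ω) j (k * ρ ^ ν) * ρ ^ j| ≤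
        C * η * (ρ ^ N * ρ ^ p) * (Real.exp (-c * (k * ρ ^ ν)) * sphereBound N gc Ω) := by
  obtain ⟨K, hK0, hK⟩ : ∃ K : ℝ, 0 ≤ K ∧
      ∀ Ω, truncNorm N (posSeries fun i => fc i Ω) ≤ K := by
    obtain ⟨K, hK0, hK⟩ := exists_abs_le_of_continuous
      (φ := fun Ω => truncNorm N (posSeries fun i => fc i Ω))
      (continuous_finsetSum _ fun j hj =>
        (continuous_coeff_posSeries hfc (by have := Finset.mem_range.1 hj; omega)).abs)
    exact ⟨K, hK0.le, fun Ω => (le_abs_self _).trans (hK Ω)⟩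
  -- Compactness bounds `1 / f_0` by some `M`, hence `f_0 ≥ 1 / M`. The threefold margin is spent on
  -- the growth of `e^(-u D)`, on the polynomial in `u`, and on the decay that must remain.
  obtain ⟨c, hc, hcf⟩ : ∃ c : ℝ, 0 < c ∧ ∀ Ω, 3 * c ≤ fc 0 Ω := by
    obtain ⟨M, hM, hMf⟩ := exists_abs_le_of_continuous
      ((hfc 0 (Nat.zero_le _)).inv₀ fun Ω => (hfc0 Ω).ne')
    refine ⟨M⁻¹ / 3, by positivity, fun Ω => ?_⟩
    have := (le_abs_self _).trans (hMf Ω)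
    rw [mul_div_cancel₀ _ (by norm_num)]
    exact inv_le_of_inv_le₀ (hfc0 Ω) this
  obtain ⟨C₁, hC₁, H₁⟩ := exists_abs_expCoeff_le gc hc hK hK0 hcf
  obtain ⟨C₂, hC₂, H₂⟩ := exists_abs_exp_mul_sub_truncEval_le hN (c := c) hK0
  obtain ⟨C₃, hC₃, H₃⟩ := exists_pow_mul_exp_le (N + 1) hc
  refine ⟨C₁ + C₂ * C₃, c, by positivity, hc, fun Ω j hj u hu => ?_, fun η hη hη1 => ?_⟩
  · refine (H₁ Ω j hj u hu).trans ?_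
    have := sphereBound_nonneg N gc Ω
    gcongr
    linarith [mul_nonneg hC₂ hC₃]
  obtain ⟨δ₁, hδ₁, hf⟩ := hfexp η hη
  obtain ⟨δ₂, hδ₂, hg⟩ := hgexp η hη
  -- Besides the validity of both expansions, the radius enforces `ρ ≤ η` and `(K + 1) ρ ≤ c`, as
  -- the Taylor estimate requires.
  refine ⟨min (min δ₁ δ₂) (min η (c / (K + 1))), by positivity, fun k hk ρ hρ hρδ Ω => ?_⟩
  simp only [lt_min_iff] at hρδ
  obtain ⟨⟨hρ1, hρ2⟩, hρη, hρc⟩ := hρδ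
  specialize hf ρ hρ hρ1 Ω
  specialize hg ρ hρ hρ2 Ω
  set x : EuclideanSpace ℝ (Fin d) := ρ • (Ω : EuclideanSpace ℝ (Fin d)) with hx
  have hB := sphereBound_nonneg N gc Ω
  set P := posSeries fun i => fc i Ω with hP
  set Q := PowerSeries.mk fun i => gc i Ω with hQ
  set u := k * ρ ^ ν with hu
  have hρν : 0 < ρ ^ ν := Real.rpow_pos_of_pos hρ _
  have hρp : 0 < ρ ^ p := Real.rpow_pos_of_pos hρ _
  have hu0 : 0 ≤ u := by positivity
  have hD : |(f x / ρ ^ ν - fc 0 Ω) - truncEval N ρ P| ≤ η * ρ ^ N := by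
    have e : truncEval N ρ P = ∑ j ∈ Finset.range (N + 1), fc j Ω * ρ ^ j - fc 0 Ω := by
      rw [truncEval, Finset.sum_range_succ', Finset.sum_range_succ' (fun j => fc j Ω * ρ ^ j)]
      simp [hP, posSeries]
    rw [e, show f x / ρ ^ ν - fc 0 Ω - (∑ j ∈ Finset.range (N + 1), fc j Ω * ρ ^ j - fc 0 Ω) =
      (f x - ρ ^ ν * ∑ j ∈ Finset.range (N + 1), fc j Ω * ρ ^ j) / ρ ^ ν by field_simp; ring,
      abs_div, abs_of_pos hρν, div_le_iff₀ hρν, mul_assoc, ← Real.rpow_natCast,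
      ← Real.rpow_add hρ]
    exact hf
  have hG : |g x / ρ ^ p - truncEval N ρ Q| ≤ η * ρ ^ N := by
    have e : truncEval N ρ Q = ∑ j ∈ Finset.range (N + 1), gc j Ω * ρ ^ j := by
      simp [truncEval, hQ]
    rw [e, show g x / ρ ^ p - ∑ j ∈ Finset.range (N + 1), gc j Ω * ρ ^ j =
      (g x - ρ ^ p * ∑ j ∈ Finset.range (N + 1), gc j Ω * ρ ^ j) / ρ ^ p by field_simp,
      abs_div, abs_of_pos hρp, div_le_iff₀ hρp, mul_assoc, ← Real.rpow_natCast,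
      ← Real.rpow_add hρ]
    exact hg
  have hmain := H₂ P Q (f x / ρ ^ ν - fc 0 Ω) (g x / ρ ^ p) u ρ η (by simp [hP, posSeries])
    (hK Ω) hu0 hρ.le hρη.le hη1 (by rw [lt_div_iff₀ (by positivity)] at hρc; linarith) hD hG
  have e1 : Real.exp (-k * f x) * g x - ρ ^ p * ∑ j ∈ Finset.range (N + 1),
      expCoeff N (fun i => fc i Ω) (fun i => gc i Ω) j u * ρ ^ j =
      ρ ^ p * (Real.exp (-u * fc 0 Ω) *
        (Real.exp (-u * (f x / ρ ^ ν - fc 0 Ω)) * (g x / ρ ^ p) -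
          truncEval N ρ (expSeries N u P * Q))) := by
    have e2 : Real.exp (-k * f x) =
        Real.exp (-u * fc 0 Ω) * Real.exp (-u * (f x / ρ ^ ν - fc 0 Ω)) := by
      rw [← Real.exp_add]; congr 1; rw [hu]; field_simp; ring
    have e3 : ∑ j ∈ Finset.range (N + 1),
        expCoeff N (fun i => fc i Ω) (fun i => gc i Ω) j u * ρ ^ j =
        Real.exp (-u * fc 0 Ω) * truncEval N ρ (expSeries N u P * Q) := by
      rw [truncEval, Finset.mul_sum]
      exact Finset.sum_congr rfl fun j _ => mul_assoc _ _ _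
    rw [e2, e3]; field_simp
  rw [e1, abs_mul, abs_mul, Real.abs_exp, abs_of_pos hρp]
  have h2 : Real.exp (-u * fc 0 Ω) * (Real.exp (c * u) * Real.exp (c * u)) ≤
      Real.exp (-c * u) := by
    rw [← Real.exp_add, ← Real.exp_add]
    refine Real.exp_le_exp.2 ?_
    nlinarith [mul_le_mul_of_nonneg_left (hcf Ω) hu0]
  calc _ ≤ ρ ^ p * (Real.exp (-u * fc 0 Ω) * (C₂ * (η * ρ ^ N *
        ((C₃ * Real.exp (c * u)) * Real.exp (c * u)) * sphereBound N gc Ω))) := by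
        refine mul_le_mul_of_nonneg_left (mul_le_mul_of_nonneg_left (hmain.trans ?_)
          (Real.exp_pos _).le) hρp.le
        have := H₃ u hu0
        unfold sphereBound at hB ⊢
        gcongr
    _ = C₂ * C₃ * η * (ρ ^ N * ρ ^ p) * ((Real.exp (-u * fc 0 Ω) *
        (Real.exp (c * u) * Real.exp (c * u))) * sphereBound N gc Ω) := by ring
    _ ≤ (C₁ + C₂ * C₃) * η * (ρ ^ N * ρ ^ p) *
        (Real.exp (-c * u) * sphereBound N gc Ω) := by
        gcongr
        linarith

/-! ### Integrability of the coefficients of `g` -/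

/-- By Fubini almost every radius below `δ` is good, and the radii below `ε` have positive measure.
-/
lemma exists_radius_integrable (hd : 1 ≤ d) {g : EuclideanSpace ℝ (Fin d) → ℝ} {δ : ℝ}
    (hg : IntegrableOn g (Metric.ball 0 δ)) {ε : ℝ} (hε : 0 < ε) (hεδ : ε ≤ δ) :
    ∃ ρ : ℝ, 0 < ρ ∧ ρ < ε ∧ Integrable
      (fun Ω : USphere d => g (ρ • (Ω : EuclideanSpace ℝ (Fin d)))) (surfaceMeasure d) := by
  rw [← integrable_indicator_iff measurableSet_ball, ← integrable_comp_polarPoint_iff hd,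
    polarMeasure] at hg
  have h := hg.prod_left_ae
  have hpos : Measure.volumeIoiPow (d - 1) (Set.Iio (⟨ε, hε⟩ : Set.Ioi (0 : ℝ))) ≠ 0 := by
    rw [Measure.volumeIoiPow_apply_Iio]
    simp only [ne_eq, ENNReal.ofReal_eq_zero, not_le]
    positivity
  obtain ⟨ρ, hρ, hi⟩ := (frequently_ae_mem_iff.2 hpos |>.and_eventually h).exists
  have hρε : (ρ : ℝ) < ε := hρ
  refine ⟨ρ, ρ.2, hρε, hi.congr (ae_of_all _ fun Ω => ?_)⟩
  refine Set.indicator_of_mem ?_ _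
  rw [mem_ball_zero_iff, norm_polarPoint]
  exact hρε.trans_le hεδ

lemma tendsto_coeff_of_expansion {N j : ℕ} (hj : j ≤ N) {a G ρ : ℕ → ℝ} (hρ : ∀ n, 0 < ρ n)
    (hρ0 : Tendsto ρ atTop (𝓝 0))
    (hG : Tendsto (fun n => (G n - ∑ i ∈ Finset.range (N + 1), a i * ρ n ^ i) / ρ n ^ N)
      atTop (𝓝 0)) :
    Tendsto (fun n => (G n - ∑ i ∈ Finset.range j, a i * ρ n ^ i) / ρ n ^ j) atTop
      (𝓝 (a j)) := by
  obtain ⟨m, rfl⟩ := Nat.exists_eq_add_of_le hj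
  have e : ∀ n, (G n - ∑ i ∈ Finset.range j, a i * ρ n ^ i) / ρ n ^ j =
      (G n - ∑ i ∈ Finset.range (j + m + 1), a i * ρ n ^ i) / ρ n ^ (j + m) * ρ n ^ m +
      ∑ i ∈ Finset.range (m + 1), a (j + i) * ρ n ^ i := by
    intro n
    have h := (hρ n).ne'
    rw [add_assoc, Finset.sum_range_add _ j (m + 1), pow_add]
    have : ∑ i ∈ Finset.range (m + 1), a (j + i) * ρ n ^ (j + i) =
        ρ n ^ j * ∑ i ∈ Finset.range (m + 1), a (j + i) * ρ n ^ i := by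
      rw [Finset.mul_sum]
      exact Finset.sum_congr rfl fun i _ => by rw [pow_add]; ring
    rw [this]
    field_simp
    ring
  simp only [e]
  have h1 := hG.mul (hρ0.pow m)
  have h2 : Tendsto (fun n => ∑ i ∈ Finset.range (m + 1), a (j + i) * ρ n ^ i) atTop
      (𝓝 (∑ i ∈ Finset.range (m + 1), a (j + i) * 0 ^ i)) :=
    tendsto_finsetSum _ fun i _ => (hρ0.pow i).const_mul _
  rw [Finset.sum_range_succ'] at h2
  simpa using h1.add h2

/-- A polynomial of degree at most `N` is determined linearly by its values at `N + 1` distinct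
nodes; `W` is the inverse Vandermonde matrix, padded by zeros. -/
lemma exists_vandermonde_bound (N : ℕ) {ρ : ℕ → ℝ} (hρ : Function.Injective ρ) :
    ∃ W : ℕ → ℕ → ℝ, ∀ a : ℕ → ℝ, ∀ j ≤ N, a j = ∑ i ∈ Finset.range (N + 1),
      W j i * ∑ l ∈ Finset.range (N + 1), a l * ρ i ^ l := by
  set V : Matrix (Fin (N + 1)) (Fin (N + 1)) ℝ := Matrix.vandermonde fun i => ρ i with hV
  have hdet : IsUnit V.det := by
    rw [isUnit_iff_ne_zero]
    exact Matrix.det_vandermonde_ne_zero_iff.2 fun i j h => Fin.ext (hρ h)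
  refine ⟨fun j i => if h : j < N + 1 ∧ i < N + 1 then V⁻¹ ⟨j, h.1⟩ ⟨i, h.2⟩ else 0,
    fun a j hj => ?_⟩
  have h1 : V⁻¹.mulVec (V.mulVec fun l => a l) = fun l : Fin (N + 1) => a l := by
    rw [Matrix.mulVec_mulVec, Matrix.nonsing_inv_mul _ hdet, Matrix.one_mulVec]
  have h2 := congrFun h1 ⟨j, Nat.lt_succ_of_le hj⟩
  rw [← Fin.sum_univ_eq_sum_range (fun i => (if h : j < N + 1 ∧ i < N + 1 then
    V⁻¹ ⟨j, h.1⟩ ⟨i, h.2⟩ else 0) * ∑ l ∈ Finset.range (N + 1), a l * ρ i ^ l)]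
  rw [← h2, Matrix.mulVec, dotProduct]
  refine Finset.sum_congr rfl fun i _ => ?_
  rw [dif_pos ⟨Nat.lt_succ_of_le hj, i.2⟩, Matrix.mulVec, dotProduct,
    ← Fin.sum_univ_eq_sum_range (fun l => a l * ρ i ^ l)]
  congr 1
  exact Finset.sum_congr rfl fun l _ => by rw [hV, Matrix.vandermonde_apply]; ring

/-- The coefficients in a radial expansion of a locally integrable function are integrable. -/
lemma integrable_expansion_coeff (hd : 1 ≤ d) {N : ℕ} {p δ : ℝ}
    {g : EuclideanSpace ℝ (Fin d) → ℝ} {gc : ℕ → USphere d → ℝ} (hδ : 0 < δ)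
    (hg : IntegrableOn g (Metric.ball 0 δ)) (hgexp : HasRadialExpansion g p N gc) :
    ∀ j ≤ N, Integrable (gc j) (surfaceMeasure d) := by
  obtain ⟨δ₁, hδ₁, h1⟩ := hgexp 1 one_pos
  set A : Set ℝ := {ρ | 0 < ρ ∧ ρ < min δ δ₁ ∧ Integrable
      (fun Ω : USphere d => g (ρ • (Ω : EuclideanSpace ℝ (Fin d)))) (surfaceMeasure d)} with hA
  have hne : ∀ ε > 0, ∃ ρ ∈ A, ρ < ε := by
    intro ε hε
    obtain ⟨ρ, h0, hlt, hi⟩ := exists_radius_integrable hd hg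
      (ε := min ε (min δ δ₁)) (by positivity) ((min_le_right _ _).trans (min_le_left _ _))
    exact ⟨ρ, ⟨h0, hlt.trans_le (min_le_right _ _), hi⟩, hlt.trans_le (min_le_left _ _)⟩
  -- Good radii accumulate at `0`, which is not one of them, so a strictly decreasing sequence of
  -- them tends to `0`. Its limit yields measurability, and its distinctness yields Vandermonde
  -- nodes.
  have hglb : IsGLB A 0 := by
    refine ⟨fun ρ hρ => hρ.1.le, fun b hb => ?_⟩
    by_contra! hlt
    obtain ⟨ρ, hρ, hρb⟩ := hne b hlt
    exact absurd (hb hρ) (not_le.2 hρb)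
  obtain ⟨ρ, hanti, -, htend, hmem⟩ := hglb.exists_seq_strictAnti_tendsto_of_notMem
    (fun h => lt_irrefl _ h.1) (let ⟨ρ, h, _⟩ := hne 1 one_pos; ⟨ρ, h⟩)
  set G : ℕ → USphere d → ℝ := fun n Ω =>
    g (ρ n • (Ω : EuclideanSpace ℝ (Fin d))) / ρ n ^ p with hG
  have hGi : ∀ n, Integrable (G n) (surfaceMeasure d) := fun n => (hmem n).2.2.div_const _
  have hGe : ∀ (ε : ℝ) (n : ℕ) (Ω : USphere d), |g (ρ n • (Ω : EuclideanSpace ℝ (Fin d))) -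
        ρ n ^ p * ∑ j ∈ Finset.range (N + 1), gc j Ω * ρ n ^ j| ≤ ε * ρ n ^ ((N : ℝ) + p) →
      |G n Ω - ∑ j ∈ Finset.range (N + 1), gc j Ω * ρ n ^ j| ≤ ε * ρ n ^ N := by
    intro ε n Ω h
    have hρp : 0 < ρ n ^ p := Real.rpow_pos_of_pos (hmem n).1 _
    rw [hG, show g (ρ n • (Ω : EuclideanSpace ℝ (Fin d))) / ρ n ^ p -
      ∑ j ∈ Finset.range (N + 1), gc j Ω * ρ n ^ j =
      (g (ρ n • (Ω : EuclideanSpace ℝ (Fin d))) -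
        ρ n ^ p * ∑ j ∈ Finset.range (N + 1), gc j Ω * ρ n ^ j) / ρ n ^ p by field_simp,
      abs_div, abs_of_pos hρp, div_le_iff₀ hρp, mul_assoc, ← Real.rpow_natCast,
      ← Real.rpow_add (hmem n).1]
    exact h
  have hlim : ∀ Ω, Tendsto (fun n => (G n Ω - ∑ i ∈ Finset.range (N + 1), gc i Ω * ρ n ^ i) /
      ρ n ^ N) atTop (𝓝 0) := by
    intro Ω
    rw [Metric.tendsto_nhds]
    intro ε hε
    obtain ⟨δ₂, hδ₂, h2⟩ := hgexp (ε / 2) (by positivity)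
    filter_upwards [htend.eventually (gt_mem_nhds hδ₂)] with n hn
    have hN : 0 < ρ n ^ N := pow_pos (hmem n).1 _
    rw [dist_zero_right, Real.norm_eq_abs, abs_div, abs_of_pos hN, div_lt_iff₀ hN]
    refine (hGe _ n Ω (h2 _ (hmem n).1 hn Ω)).trans_lt ?_
    nlinarith
  -- Strong induction: once the lower coefficients are measurable, `g_j` is a pointwise limit of
  -- measurable functions.
  have hmeas : ∀ j ≤ N, AEStronglyMeasurable (gc j) (surfaceMeasure d) := by
    intro j
    induction j using Nat.strong_induction_on with
    | _ j ih =>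
      intro hj
      refine aestronglyMeasurable_of_tendsto_ae atTop
        (f := fun n Ω => (G n Ω - ∑ i ∈ Finset.range j, gc i Ω * ρ n ^ i) / ρ n ^ j)
        (fun n => ?_) (ae_of_all _ fun Ω =>
          tendsto_coeff_of_expansion hj (fun n => (hmem n).1) htend (hlim Ω))
      have hs : AEStronglyMeasurable (fun Ω => ∑ i ∈ Finset.range j, gc i Ω * ρ n ^ i)
          (surfaceMeasure d) :=
        Finset.aestronglyMeasurable_fun_sum _ fun i hi =>
          (ih i (Finset.mem_range.1 hi) ((Finset.mem_range.1 hi).le.trans hj)).mul_const _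
      exact ((hGi n).1.sub hs).mul_const (ρ n ^ j)⁻¹
  obtain ⟨W, hW⟩ := exists_vandermonde_bound N hanti.injective
  intro j hj
  -- Interpolation writes `g_j` through the values of the polynomial at the nodes, and these differ
  -- from the integrable `G i` by at most `ρ_i^N`.
  refine Integrable.mono' (g := fun Ω => ∑ i ∈ Finset.range (N + 1),
    |W j i| * (|G i Ω| + ρ i ^ N)) ?_ (hmeas j hj) (ae_of_all _ fun Ω => ?_)
  · exact integrable_finsetSum _ fun i _ =>
      (((hGi i).abs).add (integrable_const _)).const_mul _
  · rw [Real.norm_eq_abs, hW (fun l => gc l Ω) j hj]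
    refine (Finset.abs_sum_le_sum_abs _ _).trans (Finset.sum_le_sum fun i _ => ?_)
    rw [abs_mul]
    refine mul_le_mul_of_nonneg_left ?_ (abs_nonneg _)
    have h := hGe 1 i Ω (h1 _ (hmem i).1 ((hmem i).2.1.trans_le (min_le_right _ _)) Ω)
    rw [one_mul, abs_sub_comm] at h
    have := abs_sub_abs_le_abs_sub (∑ l ∈ Finset.range (N + 1), gc l Ω * ρ i ^ l) (G i Ω)
    linarith

lemma integrable_sphereBound {N : ℕ} {gc : ℕ → USphere d → ℝ}
    (hgc : ∀ j ≤ N, Integrable (gc j) (surfaceMeasure d)) :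
    Integrable (sphereBound N gc) (surfaceMeasure d) := by
  unfold sphereBound truncNorm
  simp only [PowerSeries.coeff_mk]
  exact (integrable_const _).add (integrable_finsetSum _ fun j hj =>
    (hgc j (Nat.le_of_lt_succ (Finset.mem_range.1 hj))).abs)

lemma integrable_coeffIntegrand {N j : ℕ} {fc gc : ℕ → USphere d → ℝ} {ν lam : ℝ}
    (hfc : ∀ j ≤ N, Continuous (fc j)) (hfc0 : ∀ Ω, 0 < fc 0 Ω)
    (hgc : ∀ j ≤ N, Integrable (gc j) (surfaceMeasure d)) (hj : j ≤ N) :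
    Integrable (fun Ω => coeffIntegrand ν lam (fun i => fc i Ω) (fun i => gc i Ω) j)
      (surfaceMeasure d) := by
  simp only [coeffIntegrand, Finset.mul_sum]
  refine integrable_finsetSum _ fun m hm => ?_
  have hm' : m ≤ N := by have := Finset.mem_range.1 hm; omega
  have hcont : Continuous fun Ω => fc 0 Ω ^ (-(((j : ℝ) + lam) / ν)) *
      innerSum (((j : ℝ) + lam) / ν) (fun i => fc i Ω) m :=
    ((hfc 0 (Nat.zero_le _)).rpow_const fun Ω => Or.inl (hfc0 Ω).ne').mul
      (continuous_innerSum hfc hfc0 hm' _)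
  obtain ⟨M, -, hM⟩ := exists_abs_le_of_continuous hcont
  refine ((hgc (j - m) (by omega)).bdd_mul (c := M) hcont.aestronglyMeasurable
    (ae_of_all _ hM)).congr (ae_of_all _ fun Ω => ?_)
  ring

/-! ### Integrals of the model terms in polar coordinates -/

lemma pow_pred_mul_rpow (hd : 1 ≤ d) {x : ℝ} (hx : 0 < x) (t : ℝ) :
    x ^ (d - 1) * x ^ (t - (d : ℝ)) = x ^ (t - 1) := by
  rw [← Real.rpow_natCast, ← Real.rpow_add hx, Nat.cast_pred hd]
  congr 1; ring

lemma integrable_radial_majorant (hd : 1 ≤ d) {ν c k t : ℝ} (hν : 0 < ν) (hc : 0 < c)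
    (hk : 0 < k) (ht : 0 < t) :
    Integrable (fun x : Set.Ioi (0 : ℝ) =>
      (x : ℝ) ^ (t - (d : ℝ)) * Real.exp (-c * (k * (x : ℝ) ^ ν)))
      (Measure.volumeIoiPow (d - 1)) := by
  rw [integrable_volumeIoiPow_iff (d - 1)
    fun x => x ^ (t - (d : ℝ)) * Real.exp (-c * (k * x ^ ν))]
  refine (integrableOn_rpow_mul_pow_mul_exp hk hν hc (show -1 < t - 1 by linarith) 0).congr_fun
    (fun x hx => ?_) measurableSet_Ioi
  have hx : 0 < x := hx
  simp only [← mul_assoc]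
  rw [pow_pred_mul_rpow hd hx, pow_zero, mul_one]
  congr 2; ring

lemma integral_radial_majorant (hd : 1 ≤ d) {ν c k t : ℝ} (hν : 0 < ν) (hc : 0 < c)
    (hk : 0 < k) (ht : 0 < t) :
    ∫ x : Set.Ioi (0 : ℝ), (x : ℝ) ^ (t - (d : ℝ)) * Real.exp (-c * (k * (x : ℝ) ^ ν))
      ∂(Measure.volumeIoiPow (d - 1)) =
    (1 / ν * c ^ (-(t / ν)) * Real.Gamma (t / ν)) * k ^ (-(t / ν)) := by
  rw [integral_volumeIoiPow (d - 1) fun x => x ^ (t - (d : ℝ)) * Real.exp (-c * (k * x ^ ν))]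
  have h := integral_rpow_mul_pow_mul_exp (q := t - 1) hk hν hc (div_pos ht hν)
    (by rw [sub_add_cancel]) 0
  rw [Nat.cast_zero, add_zero, pow_zero, div_one] at h
  rw [show 1 / ν * c ^ (-(t / ν)) * Real.Gamma (t / ν) * k ^ (-(t / ν)) =
    k ^ (-(t / ν)) * (1 / ν) * c ^ (-(t / ν)) * Real.Gamma (t / ν) by ring, ← h]
  refine setIntegral_congr_fun measurableSet_Ioi fun x hx => ?_
  have hx : 0 < x := hx
  simp only [← mul_assoc]
  rw [pow_pred_mul_rpow hd hx, pow_zero, mul_one]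
  congr 2; ring

/-- The `j`-th term of the expansion of the integrand, in polar coordinates. -/
noncomputable def polarTerm (N : ℕ) (ν lam : ℝ) (fc gc : ℕ → USphere d → ℝ) (k : ℝ) (j : ℕ)
    (p : USphere d × Set.Ioi (0 : ℝ)) : ℝ :=
  (p.2 : ℝ) ^ (lam - (d : ℝ)) *
    (expCoeff N (fun i => fc i p.1) (fun i => gc i p.1) j (k * (p.2 : ℝ) ^ ν) * (p.2 : ℝ) ^ j)

lemma aestronglyMeasurable_polarTerm {N j : ℕ} {ν lam k : ℝ} {fc gc : ℕ → USphere d → ℝ}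
    (hfc : ∀ j ≤ N, Continuous (fc j)) (hgc : ∀ j ≤ N, Integrable (gc j) (surfaceMeasure d))
    (hj : j ≤ N) :
    AEStronglyMeasurable (polarTerm N ν lam fc gc k j) (polarMeasure d) := by
  unfold polarTerm
  simp only [expCoeff_eq]
  have hρ : Continuous fun p : USphere d × Set.Ioi (0 : ℝ) => (p.2 : ℝ) := by fun_prop
  have hne : ∀ p : USphere d × Set.Ioi (0 : ℝ), (p.2 : ℝ) ≠ 0 := fun p => ne_of_gt p.2.2
  have hpow : ∀ q : ℝ, Continuous fun p : USphere d × Set.Ioi (0 : ℝ) => (p.2 : ℝ) ^ q :=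
    fun q => hρ.rpow_const fun p => Or.inl (hne p)
  refine (hpow _).aestronglyMeasurable.mul
    (AEStronglyMeasurable.mul ?_ (hρ.pow j).aestronglyMeasurable)
  refine Finset.aestronglyMeasurable_fun_sum _ fun m hm =>
    Finset.aestronglyMeasurable_fun_sum _ fun r _ => ?_
  have hm' : m ≤ N := by have := Finset.mem_range.1 hm; omega
  have h1 : AEStronglyMeasurable (fun p : USphere d × Set.Ioi (0 : ℝ) => gc (j - m) p.1)
      (polarMeasure d) := (hgc (j - m) (by omega)).1.comp_fst
  have h2 : Continuous fun p : USphere d × Set.Ioi (0 : ℝ) => bell (fun i => fc i p.1) m r :=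
    (continuous_bell hfc hm' r).comp continuous_fst
  have h3 : Continuous fun p : USphere d × Set.Ioi (0 : ℝ) => fc 0 p.1 :=
    (hfc 0 (Nat.zero_le _)).comp continuous_fst
  have h4 := hpow ν
  exact (h1.mul (continuous_const.mul h2).aestronglyMeasurable).mul
    (((continuous_const.mul h4).pow r).mul
      (Real.continuous_exp.comp ((continuous_const.mul h4).neg.mul h3))).aestronglyMeasurable

lemma integrable_polarTerm (hd : 1 ≤ d) {N j : ℕ} {ν lam k C c : ℝ}
    {fc gc : ℕ → USphere d → ℝ} (hν : 0 < ν) (hlam : 0 < lam) (hk : 0 < k) (hc : 0 < c)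
    (hfc : ∀ j ≤ N, Continuous (fc j)) (hgc : ∀ j ≤ N, Integrable (gc j) (surfaceMeasure d))
    (hC : ∀ Ω, ∀ j ≤ N, ∀ u : ℝ, 0 ≤ u →
      |expCoeff N (fun i => fc i Ω) (fun i => gc i Ω) j u| ≤
        C * (Real.exp (-c * u) * sphereBound N gc Ω)) (hj : j ≤ N) :
    Integrable (polarTerm N ν lam fc gc k j) (polarMeasure d) := by
  have hmaj := (((integrable_sphereBound hgc).mul_prod (integrable_radial_majorant hd hν hc hk
    (show 0 < (j : ℝ) + lam by positivity))).const_mul C)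
  refine Integrable.mono' hmaj (aestronglyMeasurable_polarTerm hfc hgc hj)
    (ae_of_all _ fun p => ?_)
  have hρ : (0 : ℝ) < p.2 := p.2.2
  have h := hC p.1 j hj (k * (p.2 : ℝ) ^ ν) (by positivity)
  rw [Real.norm_eq_abs, polarTerm, abs_mul, abs_mul, abs_of_pos (Real.rpow_pos_of_pos hρ _),
    abs_of_pos (pow_pos hρ j)]
  calc _ ≤ (p.2 : ℝ) ^ (lam - (d : ℝ)) * ((C * (Real.exp (-c * (k * (p.2 : ℝ) ^ ν)) *
        sphereBound N gc p.1)) * (p.2 : ℝ) ^ j) := by gcongr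
    _ = _ := by
      rw [show (j : ℝ) + lam - (d : ℝ) = (lam - (d : ℝ)) + (j : ℝ) by ring,
        Real.rpow_add hρ, Real.rpow_natCast]
      ring

lemma integral_polarTerm (hd : 1 ≤ d) {N j : ℕ} {ν lam k : ℝ}
    {fc gc : ℕ → USphere d → ℝ} (hν : 0 < ν) (hlam : 0 < lam) (hk : 0 < k)
    (hfc0 : ∀ Ω, 0 < fc 0 Ω)
    (hint : Integrable (polarTerm N ν lam fc gc k j) (polarMeasure d)) (hj : j ≤ N) :
    ∫ p, polarTerm N ν lam fc gc k j p ∂(polarMeasure d) =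
      zeta ν lam fc gc j * k ^ (-(((j : ℝ) + lam) / ν)) := by
  rw [polarMeasure] at hint ⊢
  rw [integral_prod _ hint, zeta, mul_assoc, ← integral_mul_const, ← integral_const_mul]
  refine integral_congr_ae (ae_of_all _ fun Ω => ?_)
  simp only [polarTerm]
  rw [integral_volumeIoiPow (d - 1) fun x => x ^ (lam - (d : ℝ)) *
    (expCoeff N (fun i => fc i Ω) (fun i => gc i Ω) j (k * x ^ ν) * x ^ j), ← mul_assoc,
    ← integral_rpow_mul_expCoeff (fun i => gc i Ω) hj hk hν (hfc0 Ω) hlam]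
  refine setIntegral_congr_fun measurableSet_Ioi fun x hx => ?_
  have hx : 0 < x := hx
  simp only [← mul_assoc]
  rw [pow_pred_mul_rpow hd hx, show (j : ℝ) + lam - 1 = (lam - 1) + (j : ℝ) by ring,
    Real.rpow_add hx, Real.rpow_natCast]
  ring

/-! ### Contribution of a small ball -/

lemma pow_le_inv_mul_pow {ρ δ : ℝ} (hδ : 0 < δ) (h : δ ≤ ρ) {j M : ℕ} (hj : j ≤ M) :
    ρ ^ j ≤ (δ ^ (M - j))⁻¹ * ρ ^ M := by
  have h1 : δ ^ (M - j) ≤ ρ ^ (M - j) := pow_le_pow_left₀ hδ.le h _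
  have hρ : 0 ≤ ρ := hδ.le.trans h
  rw [← div_eq_inv_mul, le_div_iff₀ (by positivity)]
  calc ρ ^ j * δ ^ (M - j) ≤ ρ ^ j * ρ ^ (M - j) := by gcongr
    _ = ρ ^ M := by rw [← pow_add, Nat.add_sub_cancel' hj]

/-- The contribution of a suitable small ball has the claimed expansion up to any given relative
error. -/
lemma exists_ball_integral_expansion (hd : 1 ≤ d) {N : ℕ} (hN : 1 ≤ N) {ν lam : ℝ}
    (hν : 0 < ν) (hlam : 0 < lam)
    {f g : EuclideanSpace ℝ (Fin d) → ℝ} {fc gc : ℕ → USphere d → ℝ}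
    (hfc : ∀ j ≤ N, Continuous (fc j)) (hfc0 : ∀ Ω, 0 < fc 0 Ω)
    (hgc : ∀ j ≤ N, Integrable (gc j) (surfaceMeasure d))
    (hfexp : HasRadialExpansion f ν N fc) (hgexp : HasRadialExpansion g (lam - (d : ℝ)) N gc)
    {δ₀ ε : ℝ} (hδ₀ : 0 < δ₀) (hε : 0 < ε) :
    ∃ δ : ℝ, 0 < δ ∧ δ ≤ δ₀ ∧ ∀ᶠ k : ℝ in atTop,
      IntegrableOn (fun x => Real.exp (-k * f x) * g x) (Metric.ball 0 δ) →
      |(∫ x in Metric.ball 0 δ, Real.exp (-k * f x) * g x) -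
        ∑ j ∈ Finset.range (N + 1), zeta ν lam fc gc j * k ^ (-(((j : ℝ) + lam) / ν))| ≤
      ε * k ^ (-(((N : ℝ) + lam) / ν)) := by
  obtain ⟨C, c, hC0, hc, hC, H⟩ := exists_integrand_estimate hN hfc hfc0 hfexp hgexp
  set B : ℝ := ∫ Ω, sphereBound N gc Ω ∂(surfaceMeasure d) with hB
  set M : ℝ → ℝ := fun t => 1 / ν * c ^ (-(t / ν)) * Real.Gamma (t / ν) with hM
  have hB0 : 0 ≤ B := integral_nonneg fun Ω => sphereBound_nonneg N gc Ω
  have hNl : 0 < (N : ℝ) + lam := by positivity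
  have hN1 : 0 < (N : ℝ) + 1 + lam := by positivity
  have hM0 : 0 ≤ M (N + lam) := by
    have := Real.Gamma_pos_of_pos (div_pos hNl hν)
    simp only [hM]; positivity
  -- `η` makes the remainder inside the ball cost at most `ε / 2`; the added `1` in the denominator
  -- avoids division by zero.
  obtain ⟨η, hη, hη1, hηε⟩ : ∃ η : ℝ, 0 < η ∧ η ≤ 1 ∧ C * η * (B * M (N + lam)) ≤ ε / 2 := by
    refine ⟨min 1 (ε / 2 / (C * (B * M (N + lam)) + 1)), by positivity, min_le_left _ _, ?_⟩
    have h0 : 0 ≤ C * (B * M (N + lam)) := by positivity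
    have h := min_le_right 1 (ε / 2 / (C * (B * M (N + lam)) + 1))
    rw [le_div_iff₀ (by positivity)] at h
    have h' : 0 < min 1 (ε / 2 / (C * (B * M (N + lam)) + 1)) := by positivity
    nlinarith
  obtain ⟨δ₁, hδ₁, hest⟩ := H η hη hη1
  set δ := min δ₁ δ₀ with hδdef
  have hδ : 0 < δ := by positivity
  -- For `ρ ≥ δ` each `ρ^j` is at most `δ^(-(N+1-j)) ρ^(N+1)`. Hence the model terms outside the
  -- ball are bounded by a term one order higher, of size `k^(-(N+1+λ)/ν)`.
  set Cδ : ℝ := C * ∑ j ∈ Finset.range (N + 1), (δ ^ (N + 1 - j))⁻¹ with hCδ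
  refine ⟨δ, hδ, min_le_right _ _, ?_⟩
  have hsmall : (fun k : ℝ => (Cδ * (B * M (N + 1 + lam))) * k ^ (-(((N : ℝ) + 1 + lam) / ν)))
      =o[atTop] fun k : ℝ => k ^ (-(((N : ℝ) + lam) / ν)) := by
    refine IsLittleO.const_mul_left (isLittleO_of_tendsto' ?_ ?_) _
    · filter_upwards [eventually_gt_atTop 0] with k hk h
      exact absurd h (Real.rpow_pos_of_pos hk _).ne'
    · refine (tendsto_rpow_neg_atTop (one_div_pos.2 hν)).congr' ?_
      filter_upwards [eventually_gt_atTop 0] with k hk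
      rw [← Real.rpow_sub hk]
      congr 1; ring
  filter_upwards [hsmall.def (half_pos hε), eventually_gt_atTop 0] with k hks hk hint
  rw [← integrable_indicator_iff Metric.isOpen_ball.measurableSet,
    ← integrable_comp_polarPoint_iff hd] at hint
  rw [← integral_indicator Metric.isOpen_ball.measurableSet, ← integral_comp_polarPoint hd]
  set Φ : EuclideanSpace ℝ (Fin d) → ℝ :=
    (Metric.ball 0 δ).indicator fun x => Real.exp (-k * f x) * g x with hΦ
  have hterm : ∀ j ∈ Finset.range (N + 1),
      Integrable (polarTerm N ν lam fc gc k j) (polarMeasure d) := fun j hj =>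
    integrable_polarTerm hd hν hlam hk hc hfc hgc hC (Nat.le_of_lt_succ (Finset.mem_range.1 hj))
  have hsum : ∑ j ∈ Finset.range (N + 1), zeta ν lam fc gc j * k ^ (-(((j : ℝ) + lam) / ν)) =
      ∫ p, ∑ j ∈ Finset.range (N + 1), polarTerm N ν lam fc gc k j p ∂(polarMeasure d) := by
    rw [integral_finsetSum _ hterm]
    exact Finset.sum_congr rfl fun j hj => (integral_polarTerm hd hν hlam hk hfc0 (hterm j hj)
      (Nat.le_of_lt_succ (Finset.mem_range.1 hj))).symm
  rw [hsum, ← integral_sub hint (integrable_finsetSum _ hterm)]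
  set m : ℝ → USphere d × Set.Ioi (0 : ℝ) → ℝ := fun t p => sphereBound N gc p.1 *
    ((p.2 : ℝ) ^ (t - (d : ℝ)) * Real.exp (-c * (k * (p.2 : ℝ) ^ ν))) with hm
  have hmi : ∀ t, 0 < t → Integrable (m t) (polarMeasure d) := fun t ht =>
    (integrable_sphereBound hgc).mul_prod (integrable_radial_majorant hd hν hc hk ht)
  have hmv : ∀ t, 0 < t → ∫ p, m t p ∂(polarMeasure d) = B * M t * k ^ (-(t / ν)) := by
    intro t ht
    rw [hm, polarMeasure, integral_prod_mul (sphereBound N gc) (fun x : Set.Ioi (0 : ℝ) =>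
      (x : ℝ) ^ (t - (d : ℝ)) * Real.exp (-c * (k * (x : ℝ) ^ ν))),
      integral_radial_majorant hd hν hc hk ht, ← mul_assoc]
  -- A single global majorant: the first term controls the remainder for `ρ < δ`, the second the
  -- model terms for `ρ ≥ δ`, where `Φ` vanishes.
  have hbound : ∀ p, ‖Φ (polarPoint p) - ∑ j ∈ Finset.range (N + 1),
      polarTerm N ν lam fc gc k j p‖ ≤ C * η * m (N + lam) p + Cδ * m (N + 1 + lam) p := by
    rintro ⟨Ω, ρ, hρ⟩
    have hρ : 0 < ρ := hρ
    have hSB := sphereBound_nonneg N gc Ω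
    have hρp : 0 < ρ ^ (lam - (d : ℝ)) := Real.rpow_pos_of_pos hρ _
    have hCδ0 : 0 ≤ Cδ := by positivity
    have hm0 : ∀ t, 0 ≤ m t (Ω, ⟨ρ, hρ⟩) := fun t => by simp only [hm]; positivity
    have hmpow : ∀ n : ℕ, ρ ^ n * ρ ^ (lam - (d : ℝ)) *
        (Real.exp (-c * (k * ρ ^ ν)) * sphereBound N gc Ω) =
        m ((n : ℝ) + lam) (Ω, ⟨ρ, hρ⟩) := by
      intro n
      simp only [hm]
      rw [show (n : ℝ) + lam - (d : ℝ) = (n : ℝ) + (lam - (d : ℝ)) by ring, Real.rpow_add hρ,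
        Real.rpow_natCast]
      ring
    rw [Real.norm_eq_abs]
    rcases lt_or_ge ρ δ with hlt | hge
    · have hmem : polarPoint ((Ω, ⟨ρ, hρ⟩) : USphere d × Set.Ioi (0 : ℝ)) ∈
          Metric.ball (0 : EuclideanSpace ℝ (Fin d)) δ := by
        rw [mem_ball_zero_iff, norm_polarPoint]; exact hlt
      rw [hΦ, Set.indicator_of_mem hmem]
      have h := hest k hk ρ hρ (hlt.trans_le (min_le_left _ _)) Ω
      simp only [polarTerm, polarPoint, ← Finset.mul_sum]
      refine h.trans ?_
      rw [mul_assoc (C * η), hmpow N]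
      exact le_add_of_nonneg_right (mul_nonneg hCδ0 (hm0 _))
    · have hmem : polarPoint ((Ω, ⟨ρ, hρ⟩) : USphere d × Set.Ioi (0 : ℝ)) ∉
          Metric.ball (0 : EuclideanSpace ℝ (Fin d)) δ := by
        rw [mem_ball_zero_iff, norm_polarPoint]; exact not_lt.2 hge
      rw [hΦ, Set.indicator_of_notMem hmem, zero_sub, abs_neg]
      have h : |∑ j ∈ Finset.range (N + 1), polarTerm N ν lam fc gc k j (Ω, ⟨ρ, hρ⟩)| ≤
          Cδ * m (N + 1 + lam) (Ω, ⟨ρ, hρ⟩) := by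
        have h1 := hmpow (N + 1)
        push_cast at h1
        rw [← h1, hCδ, Finset.mul_sum, Finset.sum_mul]
        refine (Finset.abs_sum_le_sum_abs _ _).trans (Finset.sum_le_sum fun j hj => ?_)
        have hj' : j ≤ N := Nat.le_of_lt_succ (Finset.mem_range.1 hj)
        have h2 := hC Ω j hj' (k * ρ ^ ν) (by positivity)
        have h3 := pow_le_inv_mul_pow hδ hge (show j ≤ N + 1 by omega)
        simp only [polarTerm]
        rw [abs_mul, abs_mul, abs_of_pos hρp, abs_of_pos (pow_pos hρ j)]
        calc _ ≤ ρ ^ (lam - (d : ℝ)) * (C * (Real.exp (-c * (k * ρ ^ ν)) *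
              sphereBound N gc Ω) * ((δ ^ (N + 1 - j))⁻¹ * ρ ^ (N + 1))) := by gcongr
          _ = _ := by ring
      exact h.trans (le_add_of_nonneg_left (mul_nonneg (by positivity) (hm0 _)))
  have hfin := norm_integral_le_of_norm_le
    (((hmi _ hNl).const_mul (C * η)).add ((hmi _ hN1).const_mul Cδ)) (ae_of_all _ hbound)
  rw [Real.norm_eq_abs] at hfin
  refine hfin.trans ?_
  simp only [Pi.add_apply]
  rw [integral_add ((hmi _ hNl).const_mul (C * η)) ((hmi _ hN1).const_mul Cδ),
    integral_const_mul, integral_const_mul, hmv _ hNl, hmv _ hN1]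
  have hkN : 0 < k ^ (-(((N : ℝ) + lam) / ν)) := Real.rpow_pos_of_pos hk _
  rw [Real.norm_eq_abs, Real.norm_eq_abs, abs_of_pos hkN] at hks
  have h5 := (le_abs_self _).trans hks
  have h6 := mul_le_mul_of_nonneg_right hηε hkN.le
  linarith

/-! ### Boundedness near the origin and decay away from it -/

lemma exists_radial_bound {N : ℕ} {ν : ℝ} (hν : 0 < ν) {f : EuclideanSpace ℝ (Fin d) → ℝ}
    {fc : ℕ → USphere d → ℝ} (hfc : ∀ j ≤ N, Continuous (fc j)) (hf0 : f 0 = 0)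
    (hfexp : HasRadialExpansion f ν N fc) :
    ∃ M δ : ℝ, 0 < δ ∧ ∀ x ∈ Metric.ball (0 : EuclideanSpace ℝ (Fin d)) δ, f x ≤ M := by
  obtain ⟨δ, hδ, h⟩ := hfexp 1 one_pos
  obtain ⟨K, hK0, hK⟩ := exists_abs_le_of_continuous
    (φ := fun Ω => ∑ j ∈ Finset.range (N + 1), |fc j Ω|)
    (continuous_finsetSum _ fun j hj =>
      (hfc j (by have := Finset.mem_range.1 hj; omega)).abs)
  refine ⟨1 + K, min δ 1, by positivity, fun x hx => ?_⟩
  rcases eq_or_ne x 0 with rfl | hx0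
  · rw [hf0]; linarith
  rw [mem_ball_zero_iff, lt_min_iff] at hx
  have hn : 0 < ‖x‖ := norm_pos_iff.2 hx0
  set Ω : USphere d := ⟨‖x‖⁻¹ • x, by simp [norm_smul, hn.ne']⟩ with hΩ
  have hxΩ : ‖x‖ • (Ω : EuclideanSpace ℝ (Fin d)) = x := by
    simp [hΩ, smul_smul, hn.ne']
  have h1 := h ‖x‖ hn hx.1 Ω
  rw [hxΩ] at h1
  have h2 : ‖x‖ ^ ((N : ℝ) + ν) ≤ 1 := Real.rpow_le_one hn.le hx.2.le (by positivity)
  have h3 : ‖x‖ ^ ν ≤ 1 := Real.rpow_le_one hn.le hx.2.le hν.le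
  have h4 : |∑ j ∈ Finset.range (N + 1), fc j Ω * ‖x‖ ^ j| ≤ K := by
    refine (Finset.abs_sum_le_sum_abs _ _).trans
      (le_trans (Finset.sum_le_sum fun j _ => ?_) ((le_abs_self _).trans (hK Ω)))
    rw [abs_mul, abs_of_pos (pow_pos hn j)]
    exact mul_le_of_le_one_right (abs_nonneg _) (pow_le_one₀ hn.le hx.2.le)
  have h5 : ‖x‖ ^ ν * ∑ j ∈ Finset.range (N + 1), fc j Ω * ‖x‖ ^ j ≤ K := by
    refine (le_abs_self _).trans ?_
    rw [abs_mul, abs_of_pos (Real.rpow_pos_of_pos hn _)]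
    exact (mul_le_of_le_one_left (abs_nonneg _) h3).trans h4
  have h6 := (abs_le.1 h1).2
  linarith

lemma integrableOn_exp_mul_of_le {R : Set (EuclideanSpace ℝ (Fin d))}
    {f g : EuclideanSpace ℝ (Fin d) → ℝ} (hR : NullMeasurableSet R volume)
    (hf : AEMeasurable f (volume.restrict R)) (hg : AEMeasurable g (volume.restrict R))
    (hfnonneg : ∀ x ∈ R, 0 ≤ f x) {k₀ k : ℝ} (hk : k₀ ≤ k)
    (hint : IntegrableOn (fun x => Real.exp (-k₀ * f x) * g x) R volume) :
    IntegrableOn (fun x => Real.exp (-k * f x) * g x) R volume := by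
  refine Integrable.mono hint ((hf.const_mul (-k)).exp.mul hg).aestronglyMeasurable ?_
  filter_upwards [ae_restrict_mem₀ hR] with x hx
  rw [norm_mul, norm_mul, Real.norm_eq_abs, Real.abs_exp, Real.norm_eq_abs (Real.exp _),
    Real.abs_exp]
  refine mul_le_mul_of_nonneg_right (Real.exp_le_exp.2 ?_) (norm_nonneg _)
  nlinarith [mul_le_mul_of_nonneg_right hk (hfnonneg x hx)]

/-- A region on which `f` is bounded away from zero contributes only an exponentially small
amount. -/
lemma abs_setIntegral_exp_mul_le {S : Set (EuclideanSpace ℝ (Fin d))}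
    {f g : EuclideanSpace ℝ (Fin d) → ℝ} (hS : NullMeasurableSet S volume) {A k₀ k : ℝ}
    (hA : ∀ x ∈ S, A ≤ f x) (hk : k₀ ≤ k)
    (hint : IntegrableOn (fun x => Real.exp (-k₀ * f x) * g x) S volume) :
    |∫ x in S, Real.exp (-k * f x) * g x| ≤
      (Real.exp (k₀ * A) * ∫ x in S, |Real.exp (-k₀ * f x) * g x|) * Real.exp (-A * k) := by
  -- Since `k ≥ k₀` and `f ≥ A`, the factor `e^(-(k-k₀) f)` is at most `e^(k₀ A) e^(-A k)`.
  have h := norm_integral_le_of_norm_le (f := fun x => Real.exp (-k * f x) * g x)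
    (hint.abs.const_mul (Real.exp (k₀ * A) * Real.exp (-A * k))) ?_
  · rw [integral_const_mul, Real.norm_eq_abs] at h
    linarith
  · filter_upwards [ae_restrict_mem₀ hS] with x hx
    rw [norm_mul, abs_mul, Real.norm_eq_abs, Real.abs_exp, Real.norm_eq_abs, Real.abs_exp,
      ← mul_assoc, ← Real.exp_add, ← Real.exp_add]
    refine mul_le_mul_of_nonneg_right (Real.exp_le_exp.2 ?_) (abs_nonneg _)
    nlinarith [mul_le_mul_of_nonneg_left (hA x hx) (sub_nonneg.2 hk)]

end LaplaceExpansion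

/-! ### Assembly of the expansion -/

theorem theorem2p1
    (d : ℕ) (hd : 1 ≤ d)
    (R : Set (EuclideanSpace ℝ (Fin d)))
    (f g : EuclideanSpace ℝ (Fin d) → ℝ)
    -- `R` and the functions `f`, `g` on `R` are Lebesgue measurable
    (hR : NullMeasurableSet R volume)
    (hf : AEMeasurable f (volume.restrict R))
    (hg : AEMeasurable g (volume.restrict R))
    (hR0 : (0 : EuclideanSpace ℝ (Fin d)) ∈ interior R)
    -- `f` has the unique minimum value `0` at `0`, and is bounded away from zero elsewhere
    (hf0 : f 0 = 0)
    (hfpos : ∀ x ∈ R, x ≠ 0 → 0 < f x)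
    (hfaway : ∀ δ : ℝ, 0 < δ → ∃ A : ℝ, 0 < A ∧ ∀ x ∈ R, δ ≤ ‖x‖ → A ≤ f x)
    (N : ℕ) (hN : 1 ≤ N)
    (ν : ℝ) (hν : 0 < ν) (fc : ℕ → LaplaceExpansion.USphere d → ℝ)
    (hfc : ∀ j ≤ N, Continuous (fc j))
    (hfc0 : ∀ Ω, 0 < fc 0 Ω)
    (hfexp : LaplaceExpansion.HasRadialExpansion f ν N fc)
    (lam : ℝ) (hlam : 0 < lam) (gc : ℕ → LaplaceExpansion.USphere d → ℝ)
    (hgexp : LaplaceExpansion.HasRadialExpansion g (lam - (d : ℝ)) N gc)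
    (k₀ : ℝ) (hk₀ : 0 < k₀)
    (hint : IntegrableOn (fun x => Real.exp (-k₀ * f x) * g x) R volume) :
    -- the integrals in the expansion and in its coefficients converge
    (∀ k : ℝ, k₀ ≤ k → IntegrableOn (fun x => Real.exp (-k * f x) * g x) R volume) ∧
    (∀ j ≤ N, Integrable
      (fun Ω => LaplaceExpansion.coeffIntegrand ν lam (fun i => fc i Ω) (fun i => gc i Ω) j)
      (LaplaceExpansion.surfaceMeasure d)) ∧
    (fun k : ℝ => (∫ x in R, Real.exp (-k * f x) * g x) -
        ∑ j ∈ Finset.range (N + 1),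
          LaplaceExpansion.zeta ν lam fc gc j * k ^ (-(((j : ℝ) + lam) / ν)))
      =o[atTop] (fun k : ℝ => k ^ (-(((N : ℝ) + lam) / ν))) := by
  have hfnonneg : ∀ x ∈ R, 0 ≤ f x := fun x hx => by
    rcases eq_or_ne x 0 with rfl | h
    · exact hf0.ge
    · exact (hfpos x hx h).le
  have hI : ∀ k : ℝ, k₀ ≤ k → IntegrableOn (fun x => Real.exp (-k * f x) * g x) R volume :=
    fun k hk => LaplaceExpansion.integrableOn_exp_mul_of_le hR hf hg hfnonneg hk hint
  obtain ⟨δR, hδR, hball⟩ := Metric.isOpen_iff.1 isOpen_interior 0 hR0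
  have hballR : Metric.ball 0 δR ⊆ R := hball.trans interior_subset
  obtain ⟨M, δM, hδM, hM⟩ := LaplaceExpansion.exists_radial_bound hν hfc hf0 hfexp
  have hgc : ∀ j ≤ N, Integrable (gc j) (LaplaceExpansion.surfaceMeasure d) := by
    have hsub : Metric.ball 0 (min δR δM) ⊆ R :=
      (Metric.ball_subset_ball (min_le_left _ _)).trans hballR
    refine LaplaceExpansion.integrable_expansion_coeff hd (δ := min δR δM) (by positivity) ?_
      hgexp
    -- Near the origin `f` is bounded above, so multiplying the integrable `e^(-k₀ f) g` by the
    -- bounded `e^(k₀ f)` shows that `g` is integrable there.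
    have hexp : AEStronglyMeasurable (fun x => Real.exp (k₀ * f x))
        (volume.restrict (Metric.ball 0 (min δR δM))) :=
      ((hf.mono_set hsub).const_mul k₀).exp.aestronglyMeasurable
    refine ((hint.mono_set hsub).bdd_mul (c := Real.exp (k₀ * M)) hexp ?_).congr
      (ae_of_all _ fun x => ?_)
    · filter_upwards [ae_restrict_mem measurableSet_ball] with x hx
      rw [Real.norm_eq_abs, Real.abs_exp]
      exact Real.exp_le_exp.2 (mul_le_mul_of_nonneg_left
        (hM x (Metric.ball_subset_ball (min_le_right _ _) hx)) hk₀.le)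
    · simp only
      rw [← mul_assoc, ← Real.exp_add]
      simp
  refine ⟨hI, fun j hj => LaplaceExpansion.integrable_coeffIntegrand hfc hfc0 hgc hj, ?_⟩
  rw [isLittleO_iff]
  intro ε hε
  -- The ball may depend on `ε`: for any fixed `δ` the rest of `R` contributes `O(e^(-A k))`, which
  -- is negligible against every power of `k`.
  obtain ⟨δ, hδ, hδδ, hnear⟩ := LaplaceExpansion.exists_ball_integral_expansion hd hN hν hlam
    hfc hfc0 hgc hfexp hgexp hδR (half_pos hε)
  obtain ⟨A, hA, hfA⟩ := hfaway δ hδ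
  have hsub : Metric.ball 0 δ ⊆ R := (Metric.ball_subset_ball hδδ).trans hballR
  have hfar := (isLittleO_exp_neg_mul_rpow_atTop hA (-(((N : ℝ) + lam) / ν))).const_mul_left
    (Real.exp (k₀ * A) * ∫ x in R \ Metric.ball 0 δ, |Real.exp (-k₀ * f x) * g x|)
  have hRδ : NullMeasurableSet (R \ Metric.ball 0 δ) volume :=
    hR.diff measurableSet_ball.nullMeasurableSet
  have hfAδ : ∀ x ∈ R \ Metric.ball 0 δ, A ≤ f x := fun x hx =>
    hfA x hx.1 (not_lt.1 fun h => hx.2 (mem_ball_zero_iff.2 h))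
  have hintδ : IntegrableOn (fun x => Real.exp (-k₀ * f x) * g x) (R \ Metric.ball 0 δ) volume :=
    hint.mono_set Set.sdiff_subset
  filter_upwards [hnear, hfar.def (half_pos hε), eventually_ge_atTop k₀] with k h1 h2 hk
  have h3 := h1 ((hI k hk).mono_set hsub)
  have h4 := LaplaceExpansion.abs_setIntegral_exp_mul_le hRδ hfAδ hk hintδ
  have hkN : 0 < k ^ (-(((N : ℝ) + lam) / ν)) := Real.rpow_pos_of_pos (hk₀.trans_le hk) _
  rw [← integral_inter_add_sdiff measurableSet_ball (hI k hk), Set.inter_eq_right.2 hsub]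
  rw [Real.norm_eq_abs, Real.norm_eq_abs, abs_of_pos hkN] at h2 ⊢
  have h5 := h4.trans ((le_abs_self _).trans h2)
  rw [add_sub_right_comm]
  refine (abs_add_le _ _).trans ?_
  linarith
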